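/- Let $m\ge 0$ and let $\mathcal L_t$, $t>0$, be a family of probability distributions on $\mathbb R$, $Z_t\sim\mathcal L_t$, with $EZ_t^{2m}<\infty$ for all $t>0$, closed under independent addition: if $Z_s\sim\mathcal L_s$ and $Z_t\sim\mathcal L_t$ are independent then $Z_s+Z_t\sim\mathcal L_{s+t}$. For every $t>0$ let $P_t^0,\dots,P_t^m$ be monic polynomials, $P_t^k$ of degree $k$, with $E[P_t^j(Z_t)P_t^k(Z_t)]=0$ for $j\ne k$ and $E[P_t^k(Z_t)^2]>0$, and put $$\alpha_t^{(k)}=\frac1{k!}E[Z_t^kP_t^k(Z_t)],\qquad 0\le k\le m.$$ Terminology. For a random variable $X$, a measurable function $P$ and $k\ge 0$, a random variable $Y$ has the $X$–$P$ biased distribution of order $k$ if $\alpha=\frac1{k!}E[P(X)X^k]>0$ and $E[P(X)F(X)]=\alpha\,E[F^{(k)}(Y)]$ for every $F:\mathbb R\to\mathbb R$ whose $k$-th derivative exists everywhere and is measurable and for which $E|P(X)F(X)|<\infty$ and $E|F^{(k)}(Y)|<\infty$. Let $\mathcal M_t^m$ be the set of random variables $X$ with $E|X|^j<\infty$ and $EX^j=EZ_t^j$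 for $0\le j\le 2m$. Let $n\ge1$, $\lambda_1,\dots,\lambda_n>0$ and $\lambda=\lambda_1+\dots+\lambda_n$, and suppose that for some real weights $c_{\mathbf m}$ the identity $$P_\lambda^m(x_1+\dots+x_n)=\sum_{|\mathbf m|=m}c_{\mathbf m}\prod_{i=1}^nP_{\lambda_i}^{m_i}(x_i)$$ holds for all $x_1,\dots,x_n\in\mathbb R$, where $\mathbf m=(m_1,\dots,m_n)$ ranges over the multi-indices of non-negative integers with $|\mathbf m|=m_1+\dots+m_n=m$. Then: (a) $\displaystyle \alpha_\lambda^{(m)}=\sum_{|\mathbf m|=m}c_{\mathbf m}\prod_{i=1}^n\alpha_{\lambda_i}^{(m_i)}$. (b) The numbers $\displaystyle p_{\mathbf m}=c_{\mathbf m}\,\frac{\prod_{i=1}^n\alpha_{\lambda_i}^{(m_i)}}{\alpha_\lambda^{(m)}}$, $|\mathbf m|=m$, are non-negative and sum to $1$. (c) Let $X_1,\dots,X_n$ be independent with $X_i\in\mathcal M_{\lambda_i}^m$, and $W=X_1+\dots+X_n$. For $1\le i\le n$ and $0\le k\le m$ let $(X_i)_{\lambda_i}^{(k)}$ be a random variable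 having the $X_i$–$P_{\lambda_i}^k$ biased distribution of order $k$, such that the $n$ families $\big((X_i)_{\lambda_i}^{(k)}\big)_{0\le k\le m}$, $i=1,\dots,n$, are independent of each other. Let $\mathbf I=(I_1,\dots,I_n)$ be a random multi-index, independent of all the variables $(X_i)_{\lambda_i}^{(k)}$, with $P(\mathbf I=\mathbf m)=p_{\mathbf m}$ for $|\mathbf m|=m$. Then $$W_\lambda^{(m)}=\sum_{i=1}^n(X_i)_{\lambda_i}^{(I_i)}$$ has the $W$–$P_\lambda^m$ biased distribution of order $m$. -/

import Mathlib

open MeasureTheory ProbabilityTheory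
open scoped Polynomial

/-- `F` belongs to the class of functions whose `m`-th derivative exists on all of `ℝ` and is
measurable. -/
def HasMeasurableDeriv (m : ℕ) (F : ℝ → ℝ) : Prop :=
  (∀ j < m, Differentiable ℝ (iteratedDeriv j F)) ∧ Measurable (iteratedDeriv m F)

/-- The normalizing constant `α = (m!)⁻¹ E[P(X) X ^ m]` of the order `m` transformation with
biasing function `P`; here `μ` is the law of `X`. -/
noncomputable def biasConst (m : ℕ) (P : ℝ → ℝ) (μ : Measure ℝ) : ℝ :=
  (m.factorial : ℝ)⁻¹ * ∫ x, P x * x ^ m ∂μ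

/-- The law `ν` is the `X-P` biased distribution of order `m`, where `μ` is the law of `X`:
`α > 0`, and `E[P(X) F(X)] = α E[F^{(m)}(Y)]`, `Y ∼ ν`, for every `F` whose `m`-th derivative
exists and is measurable and for which both expectations exist. -/
def IsBiased (m : ℕ) (P : ℝ → ℝ) (μ ν : Measure ℝ) : Prop :=
  0 < biasConst m P μ ∧
    ∀ F : ℝ → ℝ, HasMeasurableDeriv m F →
      Integrable (fun x => P x * F x) μ →
      Integrable (iteratedDeriv m F) ν →
      ∫ x, P x * F x ∂μ = biasConst m P μ * ∫ y, iteratedDeriv m F y ∂ν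

/-- The family of laws `L t`, `t > 0`, is closed under independent addition: if `Z₁ ∼ L s` and
`Z₂ ∼ L t` are independent, then `Z₁ + Z₂ ∼ L (s + t)`. -/
def ClosedUnderIndepAddition (L : ℝ → Measure ℝ) : Prop :=
  ∀ s t : ℝ, 0 < s → 0 < t → (L s).conv (L t) = L (s + t)

/-- `p 0, …, p m` are monic polynomials of degrees `0, …, m`, orthogonal with respect to `μ`, and
nonzero in `L²(μ)`. -/
structure IsMonicOrthogonal (m : ℕ) (μ : Measure ℝ) (p : ℕ → ℝ[X]) : Prop where
  monic : ∀ k ≤ m, (p k).Monic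
  natDegree_eq : ∀ k ≤ m, (p k).natDegree = k
  orthogonal : ∀ j ≤ m, ∀ k ≤ m, j ≠ k → ∫ x, (p j).eval x * (p k).eval x ∂μ = 0
  sq_pos : ∀ k ≤ m, 0 < ∫ x, (p k).eval x ^ 2 ∂μ

/-- The law `μ` has the same (finite) moments as `ρ` up to order `2 * k`. -/
def MomentsMatch (k : ℕ) (ρ μ : Measure ℝ) : Prop :=
  ∀ j ≤ 2 * k, Integrable (fun x : ℝ => x ^ j) μ ∧ ∫ x, x ^ j ∂μ = ∫ x, x ^ j ∂ρ

/-- `α_t^{(k)} = (k!)⁻¹ E[Z_t ^ k P_t^k(Z_t)]`, where `Z_t ∼ L t` and `P_t^k` is `P t k`. -/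
noncomputable def alpha (L : ℝ → Measure ℝ) (P : ℝ → ℕ → ℝ[X]) (t : ℝ) (k : ℕ) : ℝ :=
  (k.factorial : ℝ)⁻¹ * ∫ x, x ^ k * (P t k).eval x ∂(L t)

/-- The product of the constants `α` over the coordinates of a multi-index. -/
noncomputable def alphaMulti (L : ℝ → Measure ℝ) (P : ℝ → ℕ → ℝ[X]) {n : ℕ}
    (lam : Fin n → ℝ) (k : Fin n → ℕ) : ℝ :=
  ∏ i, alpha L P (lam i) (k i)

/-- The product polynomial `∏ i, P_{λ_i}^{k_i}(x_i)` of a multi-index. -/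
noncomputable def polyMulti (P : ℝ → ℕ → ℝ[X]) {n : ℕ}
    (lam : Fin n → ℝ) (k : Fin n → ℕ) (x : Fin n → ℝ) : ℝ :=
  ∏ i, (P (lam i) (k i)).eval (x i)

/-- The finite set of multi-indices `k = (k_1, …, k_n)` with `|k| = m`. -/
def multiIndices (n m : ℕ) : Finset (Fin n → ℕ) :=
  Finset.piAntidiag Finset.univ m

/-!
Let `P` be a monic polynomial of degree `m` orthogonal to all polynomials of smaller degree. It has
`m` distinct real zeros `r₁, …, r_m`, since otherwise the product over its zeros of odd multiplicity
would be a polynomial of smaller degree not orthogonal to it. Orthogonality lets one subtract from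
`F` its interpolant at these zeros, so that `E[P(X) F(X)] = E[P(X)² F[X, r₁, …, r_m]]`, and the
Hermite–Genocchi formula turns the divided difference into an average of `F^{(m)}`. Hence a biased
distribution exists. Its characteristic function is determined away from `0` by the exponentials
`F(x) = exp (i t x)`, so a law is biased as soon as the defining relation holds for exponentials.
Exponentials factor over independent sums, and the expansion of `P_λ^m` therefore exhibits the
biased law of the sum as a mixture of convolutions. Testing the same expansion against products of
orthogonal polynomials shows that `c_k` is a multinomial coefficient, which gives the weights.
-/

/-! ### Divided differences and the Hermite–Genocchi formula -/

/-- The divided difference of `F` at the pairwise distinct nodes `x`, as a weighted sum of the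
values of `F` at the nodes. -/
noncomputable def dividedDiff {n : ℕ} (x : Fin n → ℝ) (F : ℝ → ℝ) : ℝ :=
  ∑ i, Lagrange.nodalWeight Finset.univ x i * F (x i)

section DividedDiff

variable {m : ℕ}

lemma nodalWeight_univ_zero (x : Fin (m + 1) → ℝ) :
    Lagrange.nodalWeight Finset.univ x 0 =
      ((Lagrange.nodal Finset.univ (Fin.tail x)).eval (x 0))⁻¹ := by
  rw [Lagrange.nodalWeight, Lagrange.eval_nodal, ← Finset.prod_inv_distrib, Fin.univ_succ,
    Finset.erase_cons, Finset.prod_map]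
  rfl

lemma nodalWeight_univ_succ (x : Fin (m + 1) → ℝ) (i : Fin m) :
    Lagrange.nodalWeight Finset.univ x i.succ =
      Lagrange.nodalWeight Finset.univ (Fin.tail x) i * (x i.succ - x 0)⁻¹ := by
  have herase : (Finset.univ : Finset (Fin (m + 1))).erase i.succ =
      Finset.cons 0 ((Finset.univ.erase i).map (Fin.succEmb m)) (by simp) := by
    ext j
    cases j using Fin.cases <;> simp [Fin.succ_ne_zero, eq_comm]
  rw [Lagrange.nodalWeight, herase, Finset.prod_cons, Finset.prod_map, mul_comm]
  rfl

lemma sub_eval_interpolate_eq_mul_dividedDiff (F : ℝ → ℝ) (x : Fin (m + 1) → ℝ)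
    (hx : ∀ i, x 0 ≠ Fin.tail x i) :
    F (x 0) - (Lagrange.interpolate Finset.univ (Fin.tail x) (F ∘ Fin.tail x)).eval (x 0) =
      (Lagrange.nodal Finset.univ (Fin.tail x)).eval (x 0) * dividedDiff x F := by
  have hnodal : (Lagrange.nodal Finset.univ (Fin.tail x)).eval (x 0) ≠ 0 :=
    Lagrange.eval_nodal_not_at_node fun i _ => hx i
  rw [Lagrange.eval_interpolate_not_at_node _ fun i _ => hx i, dividedDiff, Fin.sum_univ_succ,
    nodalWeight_univ_zero, mul_add, mul_inv_cancel_left₀ hnodal, sub_eq_add_neg, ← mul_neg,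
    ← Finset.sum_neg_distrib]
  congr 2
  refine Finset.sum_congr rfl fun i _ => ?_
  rw [nodalWeight_univ_succ, ← neg_sub (x 0) (x i.succ), inv_neg]
  simp only [Fin.tail, Function.comp_apply]
  ring

lemma dividedDiff_const (x : Fin (m + 2) → ℝ) (hx : Function.Injective x) (a : ℝ) :
    dividedDiff x (fun _ => a) = 0 := by
  have hne : ∀ i, x 0 ≠ Fin.tail x i := fun i => hx.ne (Fin.succ_ne_zero i).symm
  have hconst : Lagrange.interpolate Finset.univ (Fin.tail x) ((fun _ => a) ∘ Fin.tail x) =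
      Polynomial.C a :=
    (Lagrange.eq_interpolate_of_eval_eq (f := Polynomial.C a) _
      (hx.comp (Fin.succ_injective _)).injOn
      (Polynomial.degree_C_le.trans_lt (by simpa using Nat.cast_add_one_pos m))
      (fun i _ => by simp)).symm
  have h := sub_eval_interpolate_eq_mul_dividedDiff (fun _ => a) x hne
  rw [hconst, Polynomial.eval_C, sub_self, eq_comm] at h
  exact (mul_eq_zero.1 h).resolve_left (Lagrange.eval_nodal_not_at_node fun i _ => hne i)

lemma dividedDiff_eq_dividedDiff_slope (F : ℝ → ℝ) (x : Fin (m + 2) → ℝ)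
    (hx : Function.Injective x) :
    dividedDiff x F = dividedDiff (Fin.tail x) (slope F (x 0)) := by
  have hsub : dividedDiff x F = dividedDiff x (fun y => F y - F (x 0)) := by
    have h := dividedDiff_const x hx (F (x 0))
    simp only [dividedDiff, mul_sub, Finset.sum_sub_distrib] at h ⊢
    rw [h, sub_zero]
  rw [hsub, dividedDiff, Fin.sum_univ_succ, sub_self, mul_zero, zero_add, dividedDiff]
  refine Finset.sum_congr rfl fun i _ => ?_
  rw [nodalWeight_univ_succ, slope_def_field, Fin.tail]
  ring

/-- The nodes `x 1, …, x (m + 1)`, contracted towards `x 0` by the factor `u`. -/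
noncomputable def contractNodes (x : Fin (m + 2) → ℝ) (u : ℝ) : Fin (m + 1) → ℝ :=
  fun i => AffineMap.lineMap (x 0) (Fin.tail x i) u

lemma measurable_uncurry_contractNodes :
    Measurable (Function.uncurry (contractNodes (m := m))) := by
  refine measurable_pi_lambda _ fun i => ?_
  simp only [Function.uncurry, contractNodes, AffineMap.lineMap_apply, Fin.tail, vsub_eq_sub,
    vadd_eq_add, smul_eq_mul]
  fun_prop

lemma measurable_contractNodes (x : Fin (m + 2) → ℝ) : Measurable (contractNodes x) :=
  measurable_uncurry_contractNodes.of_uncurry_left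

lemma contractNodes_injective {x : Fin (m + 2) → ℝ} (hx : Function.Injective x) {u : ℝ}
    (hu : u ≠ 0) : Function.Injective (contractNodes x u) := by
  intro i j h
  simpa [contractNodes, AffineMap.lineMap_apply, Fin.tail, hu, hx.eq_iff] using h

lemma pow_mul_dividedDiff_contractNodes (G : ℝ → ℝ) (x : Fin (m + 2) → ℝ) {u : ℝ} (hu : u ≠ 0) :
    u ^ m * dividedDiff (contractNodes x u) G =
      dividedDiff (Fin.tail x) (fun y => G (AffineMap.lineMap (x 0) y u)) := by
  have hweight : ∀ i, u ^ m * Lagrange.nodalWeight Finset.univ (contractNodes x u) i =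
      Lagrange.nodalWeight Finset.univ (Fin.tail x) i := by
    intro i
    have hsub : ∀ j, contractNodes x u i - contractNodes x u j =
        u * (Fin.tail x i - Fin.tail x j) := fun j => by
      simp only [contractNodes, AffineMap.lineMap_apply, vsub_eq_sub, vadd_eq_add, smul_eq_mul]
      ring
    simp only [Lagrange.nodalWeight, hsub, mul_inv, Finset.prod_mul_distrib, Finset.prod_const,
      Finset.card_erase_of_mem (Finset.mem_univ i), Finset.card_univ, Fintype.card_fin,
      add_tsub_cancel_right, inv_pow]
    rw [mul_inv_cancel_left₀ (pow_ne_zero m hu)]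
  simp only [dividedDiff, Finset.mul_sum, ← mul_assoc, hweight]
  rfl

end DividedDiff

/-- The measure `u ^ m du` on `(0, 1]`. -/
noncomputable def powMeasure (m : ℕ) : Measure ℝ :=
  (volume.restrict (Set.Ioc 0 1)).withDensity (fun u => ENNReal.ofReal (u ^ m))

section PowMeasure

variable {m : ℕ}

instance : IsFiniteMeasure (powMeasure m) :=
  isFiniteMeasure_withDensity_ofReal (((continuous_pow m).integrableOn_Icc.mono_set
    Set.Ioc_subset_Icc_self).hasFiniteIntegral)

lemma ae_powMeasure_ne_zero : ∀ᵐ u ∂(powMeasure m), u ≠ 0 := by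
  refine (withDensity_absolutelyContinuous _ _).ae_le ?_
  filter_upwards [ae_restrict_mem measurableSet_Ioc] with u hu using hu.1.ne'

lemma integral_powMeasure (g : ℝ → ℝ) :
    ∫ u, g u ∂(powMeasure m) = ∫ u in Set.Ioc (0 : ℝ) 1, u ^ m * g u := by
  rw [powMeasure, integral_withDensity_eq_integral_toReal_smul (by fun_prop) (by simp)]
  refine setIntegral_congr_fun measurableSet_Ioc fun u hu => ?_
  simp only [ENNReal.toReal_ofReal (pow_nonneg hu.1.le m), smul_eq_mul]

lemma powMeasure_zero : powMeasure 0 = volume.restrict (Set.Ioc 0 1) := by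
  simp [powMeasure]

end PowMeasure

lemma integral_deriv_lineMap {F : ℝ → ℝ} (hF : Differentiable ℝ F) {a b : ℝ} (hab : a ≠ b)
    (hint : IntegrableOn (fun u => deriv F (AffineMap.lineMap a b u)) (Set.Ioc (0 : ℝ) 1)) :
    ∫ u in Set.Ioc (0 : ℝ) 1, deriv F (AffineMap.lineMap a b u) = slope F a b := by
  have hderiv : ∀ u ∈ Set.uIcc (0 : ℝ) 1,
      HasDerivAt (fun u : ℝ => F (AffineMap.lineMap a b u) / (b - a))
        (deriv F (AffineMap.lineMap a b u)) u := fun u _ => by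
    have h := ((hF (AffineMap.lineMap a b u)).hasDerivAt.comp u
      AffineMap.hasDerivAt_lineMap).div_const (b - a)
    rwa [mul_div_cancel_right₀ _ (sub_ne_zero.2 hab.symm)] at h
  rw [← intervalIntegral.integral_of_le zero_le_one,
    intervalIntegral.integral_eq_sub_of_hasDerivAt hderiv
      ((intervalIntegrable_iff_integrableOn_Ioc_of_le zero_le_one).2 hint),
    AffineMap.lineMap_apply_one, AffineMap.lineMap_apply_zero, ← sub_div, slope_def_field]

section HasMeasurableDeriv

variable {m : ℕ} {F : ℝ → ℝ}

lemma HasMeasurableDeriv.deriv (hF : HasMeasurableDeriv (m + 1) F) :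
    HasMeasurableDeriv m (deriv F) := by
  simp only [HasMeasurableDeriv, ← iteratedDeriv_succ']
  exact ⟨fun j hj => hF.1 _ (by lia), hF.2⟩

lemma HasMeasurableDeriv.differentiable (hF : HasMeasurableDeriv (m + 1) F) :
    Differentiable ℝ F := by
  simpa only [iteratedDeriv_zero] using hF.1 0 m.succ_pos

lemma HasMeasurableDeriv.measurable (hF : HasMeasurableDeriv m F) : Measurable F := by
  cases m with
  | zero => simpa only [iteratedDeriv_zero] using hF.2
  | succ m => exact hF.differentiable.continuous.measurable

end HasMeasurableDeriv

/-- The kernel of the Hermite–Genocchi formula: integrating the `m`-th derivative of a function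
against `hermiteGenocchi m x` gives its divided difference at the nodes `x`. -/
noncomputable def hermiteGenocchi : (m : ℕ) → Kernel (Fin (m + 1) → ℝ) ℝ
  | 0 => Kernel.deterministic (fun x => x 0) (measurable_pi_apply 0)
  | m + 1 => hermiteGenocchi m ∘ₖ
      (Kernel.id ×ₖ Kernel.const _ (powMeasure m)).map (Function.uncurry contractNodes)

section HermiteGenocchi

variable {m : ℕ}

instance : IsFiniteKernel (hermiteGenocchi m) := by
  induction m <;> unfold hermiteGenocchi <;> infer_instance

lemma hermiteGenocchi_succ_apply (x : Fin (m + 2) → ℝ) :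
    hermiteGenocchi (m + 1) x = hermiteGenocchi m ∘ₘ (powMeasure m).map (contractNodes x) := by
  rw [hermiteGenocchi, Kernel.comp_apply, Kernel.map_apply _ measurable_uncurry_contractNodes,
    Kernel.prod_apply, Kernel.id_apply, Kernel.const_apply, Measure.dirac_prod,
    Measure.map_map measurable_uncurry_contractNodes measurable_prodMk_left]
  rfl

lemma integral_measure_comp {α β E : Type*} [MeasurableSpace α] [MeasurableSpace β]
    [NormedAddCommGroup E] [NormedSpace ℝ E] {μ : Measure α} [SFinite μ] {κ : Kernel α β}
    [IsSFiniteKernel κ] {f : β → E} (hf : Integrable f (κ ∘ₘ μ)) :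
    ∫ y, f y ∂(κ ∘ₘ μ) = ∫ x, ∫ y, f y ∂(κ x) ∂μ := by
  rw [Measure.comp_eq_comp_const_apply] at hf ⊢
  rw [Kernel.integral_comp hf, Kernel.const_apply]

/-- For `m ≥ 1` the integrand is continuous; only for `m = 0` is the integrability with respect to
the kernel the integrability along the segment. -/
lemma integrableOn_deriv_lineMap_of_integrable_hermiteGenocchi {F : ℝ → ℝ}
    (hF : HasMeasurableDeriv (m + 1) F) {x : Fin (m + 2) → ℝ}
    (hint : Integrable (iteratedDeriv (m + 1) F) (hermiteGenocchi (m + 1) x)) (i : Fin (m + 1)) :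
    IntegrableOn (fun u => deriv F (AffineMap.lineMap (x 0) (Fin.tail x i) u))
      (Set.Ioc (0 : ℝ) 1) := by
  cases m with
  | zero =>
    have hmeas : Measurable (deriv F) := hF.deriv.measurable
    rw [hermiteGenocchi_succ_apply, hermiteGenocchi, Measure.deterministic_comp_eq_map,
      Measure.map_map (measurable_pi_apply 0) (measurable_contractNodes x), iteratedDeriv_one,
      integrable_map_measure hmeas.aestronglyMeasurable
        ((measurable_pi_apply 0).comp (measurable_contractNodes x)).aemeasurable,
      powMeasure_zero] at hint
    rwa [Fin.fin_one_eq_zero i]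
  | succ m =>
    have hcont : Continuous (deriv F) := hF.deriv.differentiable.continuous
    exact (hcont.comp AffineMap.lineMap_continuous).integrableOn_Icc.mono_set
      Set.Ioc_subset_Icc_self

lemma integral_dividedDiff_contractNodes {F : ℝ → ℝ} (hF : Differentiable ℝ F)
    {x : Fin (m + 2) → ℝ} (hx : Function.Injective x)
    (hint : ∀ i, IntegrableOn (fun u => deriv F (AffineMap.lineMap (x 0) (Fin.tail x i) u))
      (Set.Ioc (0 : ℝ) 1)) :
    ∫ u, dividedDiff (contractNodes x u) (deriv F) ∂(powMeasure m) = dividedDiff x F := by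
  calc ∫ u, dividedDiff (contractNodes x u) (deriv F) ∂(powMeasure m)
      = ∫ u in Set.Ioc (0 : ℝ) 1,
          dividedDiff (Fin.tail x) (fun y => deriv F (AffineMap.lineMap (x 0) y u)) := by
        rw [integral_powMeasure]
        exact setIntegral_congr_fun measurableSet_Ioc fun u hu =>
          pow_mul_dividedDiff_contractNodes (deriv F) x hu.1.ne'
    _ = dividedDiff (Fin.tail x) (slope F (x 0)) := by
        simp only [dividedDiff]
        rw [integral_finsetSum _ fun i _ => (hint i).const_mul _]
        refine Finset.sum_congr rfl fun i _ => ?_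
        have hne : x 0 ≠ Fin.tail x i := hx.ne (Fin.succ_ne_zero i).symm
        rw [integral_const_mul, integral_deriv_lineMap hF hne (hint i)]
    _ = dividedDiff x F := (dividedDiff_eq_dividedDiff_slope F x hx).symm

theorem integral_iteratedDeriv_hermiteGenocchi {F : ℝ → ℝ} {x : Fin (m + 1) → ℝ}
    (hx : Function.Injective x) (hF : HasMeasurableDeriv m F)
    (hint : Integrable (iteratedDeriv m F) (hermiteGenocchi m x)) :
    ∫ y, iteratedDeriv m F y ∂(hermiteGenocchi m x) = dividedDiff x F := by
  induction m generalizing F with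
  | zero =>
    simp [hermiteGenocchi, Kernel.deterministic_apply, dividedDiff, Lagrange.nodalWeight,
      integral_dirac' _ _ hF.measurable.stronglyMeasurable]
  | succ m ih =>
    have hseg := integrableOn_deriv_lineMap_of_integrable_hermiteGenocchi hF hint
    have hcontract := measurable_contractNodes x
    rw [hermiteGenocchi_succ_apply, iteratedDeriv_succ'] at hint
    have hae : ∀ᵐ u ∂(powMeasure m),
        Integrable (iteratedDeriv m (deriv F)) (hermiteGenocchi m (contractNodes x u)) :=
      ae_of_ae_map hcontract.aemeasurable ((Measure.integrable_comp_iff hint.1).1 hint).1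
    calc ∫ y, iteratedDeriv (m + 1) F y ∂(hermiteGenocchi (m + 1) x)
        = ∫ u, ∫ y, iteratedDeriv m (deriv F) y ∂(hermiteGenocchi m (contractNodes x u))
            ∂(powMeasure m) := by
          rw [hermiteGenocchi_succ_apply, iteratedDeriv_succ', integral_measure_comp hint,
            integral_map hcontract.aemeasurable
              hF.deriv.2.stronglyMeasurable.integral_kernel.aestronglyMeasurable]
      _ = ∫ u, dividedDiff (contractNodes x u) (deriv F) ∂(powMeasure m) := by
          refine integral_congr_ae ?_
          filter_upwards [hae, ae_powMeasure_ne_zero] with u hu hu0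
          exact ih (contractNodes_injective hx hu0) hF.deriv hu
      _ = dividedDiff x F := integral_dividedDiff_contractNodes hF.differentiable hx hseg

end HermiteGenocchi

/-! ### Orthogonal polynomials -/

section OddRoots

lemma nonneg_or_nonpos_of_forall_eval_ne_zero {P : ℝ[X]} (hP : ∀ x, P.eval x ≠ 0) :
    (∀ x, 0 ≤ P.eval x) ∨ ∀ x, P.eval x ≤ 0 := by
  by_contra! h
  obtain ⟨⟨a, ha⟩, b, hb⟩ := h
  obtain ⟨c, hc⟩ := mem_range_of_exists_le_of_exists_ge P.continuous ⟨a, ha.le⟩ ⟨b, hb.le⟩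
  exact hP c hc

lemma nonneg_or_nonpos_of_even_rootMultiplicity {P : ℝ[X]}
    (hP : ∀ a, Even (P.rootMultiplicity a)) :
    (∀ x, 0 ≤ P.eval x) ∨ ∀ x, P.eval x ≤ 0 := by
  rcases eq_or_ne P 0 with rfl | hP0
  · simp
  obtain ⟨Q, hQ, -, hroots⟩ := Polynomial.exists_prod_multiset_X_sub_C_mul P
  have hQ0 : ∀ x, Q.eval x ≠ 0 := fun x hx => by
    have hmem : x ∈ Q.roots := (Polynomial.mem_roots (right_ne_zero_of_mul (hQ ▸ hP0))).2 hx
    simp [hroots] at hmem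
  have hsq : ∀ x, 0 ≤ ∏ a ∈ P.roots.toFinset, (x - a) ^ P.rootMultiplicity a :=
    fun x => Finset.prod_nonneg fun a _ => (hP a).pow_nonneg _
  have heval : ∀ x, P.eval x =
      (∏ a ∈ P.roots.toFinset, (x - a) ^ P.rootMultiplicity a) * Q.eval x := fun x => by
    conv_lhs => rw [← hQ, Polynomial.prod_multiset_root_eq_finset_root]
    simp only [Polynomial.eval_mul, Polynomial.eval_prod, Polynomial.eval_pow, Polynomial.eval_sub,
      Polynomial.eval_X, Polynomial.eval_C]
  simp only [heval]
  exact (nonneg_or_nonpos_of_forall_eval_ne_zero hQ0).imp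
    (fun h x => mul_nonneg (hsq x) (h x))
    fun h x => mul_nonpos_of_nonneg_of_nonpos (hsq x) (h x)

/-- The roots of `P` of odd multiplicity, that is, the points at which `P` changes sign. -/
noncomputable def oddRoots (P : ℝ[X]) : Finset ℝ :=
  {a ∈ P.roots.toFinset | Odd (P.rootMultiplicity a)}

lemma nonneg_or_nonpos_mul_nodal_oddRoots (P : ℝ[X]) :
    (∀ x, 0 ≤ (P * Lagrange.nodal (oddRoots P) id).eval x) ∨
      ∀ x, (P * Lagrange.nodal (oddRoots P) id).eval x ≤ 0 := by
  rcases eq_or_ne P 0 with rfl | hP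
  · simp
  refine nonneg_or_nonpos_of_even_rootMultiplicity fun a => ?_
  have hnodal : (Lagrange.nodal (oddRoots P) id).rootMultiplicity a =
      if a ∈ oddRoots P then 1 else 0 := by
    rw [← Polynomial.count_roots, Lagrange.nodal]
    simp only [id, Polynomial.roots_prod_X_sub_C]
    exact Multiset.count_eq_of_nodup (oddRoots P).nodup
  rw [Polynomial.rootMultiplicity_mul (mul_ne_zero hP Lagrange.nodal_ne_zero), hnodal]
  split_ifs with ha
  · exact (Finset.mem_filter.1 ha).2.add_one
  · refine Nat.not_odd_iff_even.1 fun hodd => ha (Finset.mem_filter.2 ⟨?_, hodd⟩)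
    rw [Multiset.mem_toFinset, ← Multiset.count_pos, Polynomial.count_roots]
    exact hodd.pos

lemma nodal_oddRoots_dvd {P : ℝ[X]} (hP : P ≠ 0) : Lagrange.nodal (oddRoots P) id ∣ P := by
  refine (Multiset.prod_X_sub_C_dvd_iff_le_roots hP (oddRoots P).val).2 ?_
  rw [Multiset.le_iff_subset (oddRoots P).nodup]
  exact fun a ha => Multiset.mem_toFinset.1 (Finset.mem_filter.1 ha).1

end OddRoots

lemma integrable_pow_of_le {μ : Measure ℝ} [IsFiniteMeasure μ] {N j : ℕ}
    (h : Integrable (fun x : ℝ => x ^ N) μ) (hj : j ≤ N) : Integrable (fun x : ℝ => x ^ j) μ := by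
  have hN : Integrable (fun x : ℝ => ‖x‖ ^ N) μ := by simpa only [norm_pow] using h.norm
  refine (integrable_norm_iff (by fun_prop)).1 ?_
  simpa only [norm_pow] using integrable_norm_pow_of_le (by fun_prop) hj hN

lemma integrable_polynomial_eval {μ : Measure ℝ} {N : ℕ}
    (hμ : ∀ j ≤ N, Integrable (fun x : ℝ => x ^ j) μ) {Q : ℝ[X]} (hQ : Q.natDegree ≤ N) :
    Integrable (fun x => Q.eval x) μ := by
  simp_rw [Polynomial.eval_eq_sum_range]
  exact integrable_finsetSum _ fun j hj =>
    (hμ j ((Finset.mem_range_succ_iff.1 hj).trans hQ)).const_mul _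

lemma integrable_eval_mul_eval {μ : Measure ℝ} {m : ℕ}
    (hμ : ∀ j ≤ 2 * m, Integrable (fun x : ℝ => x ^ j) μ) {P Q : ℝ[X]} (hP : P.natDegree ≤ m)
    (hQ : Q.natDegree ≤ m) : Integrable (fun x => P.eval x * Q.eval x) μ := by
  have hdeg : (P * Q).natDegree ≤ 2 * m := Polynomial.natDegree_mul_le.trans (by lia)
  simpa only [Polynomial.eval_mul] using integrable_polynomial_eval hμ hdeg

/-- `P` is the monic orthogonal polynomial of degree `m` of `μ`: it is orthogonal to all polynomials
of lower degree and nonzero in `L²(μ)`. Finiteness of the moments of `μ` up to order `2 * m` is part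
of the definition, so that all the integrals involved exist. -/
structure IsOrthogonalPolynomial (m : ℕ) (P : ℝ[X]) (μ : Measure ℝ) : Prop where
  monic : P.Monic
  natDegree_eq : P.natDegree = m
  integrable_pow : ∀ j ≤ 2 * m, Integrable (fun x : ℝ => x ^ j) μ
  orthogonal : ∀ Q : ℝ[X], Q.degree < m → ∫ x, P.eval x * Q.eval x ∂μ = 0
  sq_pos : 0 < ∫ x, P.eval x ^ 2 ∂μ

namespace IsOrthogonalPolynomial

variable {m : ℕ} {P : ℝ[X]} {μ : Measure ℝ}

lemma integrable_mul (h : IsOrthogonalPolynomial m P μ) {Q : ℝ[X]} (hQ : Q.natDegree ≤ m) :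
    Integrable (fun x => P.eval x * Q.eval x) μ :=
  integrable_eval_mul_eval h.integrable_pow h.natDegree_eq.le hQ

lemma integrable (h : IsOrthogonalPolynomial m P μ) : Integrable (fun x => P.eval x) μ :=
  integrable_polynomial_eval h.integrable_pow (by rw [h.natDegree_eq]; lia)

lemma integral_mul_of_monic (h : IsOrthogonalPolynomial m P μ) {Q : ℝ[X]} (hQ : Q.Monic)
    (hQm : Q.natDegree = m) :
    ∫ x, P.eval x * Q.eval x ∂μ = ∫ x, P.eval x ^ 2 ∂μ := by
  have hdeg : (Q - P).degree < m := by
    rw [← hQm, ← Polynomial.degree_eq_natDegree hQ.ne_zero]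
    exact Polynomial.degree_sub_lt_left
      (by rw [Polynomial.degree_eq_natDegree hQ.ne_zero,
        Polynomial.degree_eq_natDegree h.monic.ne_zero, hQm, h.natDegree_eq])
      hQ.ne_zero (by rw [hQ.leadingCoeff, h.monic.leadingCoeff])
  have h0 := h.orthogonal _ hdeg
  simp only [Polynomial.eval_sub, mul_sub] at h0
  rw [integral_sub (h.integrable_mul hQm.le) (h.integrable_mul h.natDegree_eq.le),
    sub_eq_zero] at h0
  simpa only [← sq] using h0

lemma biasConst_pos (h : IsOrthogonalPolynomial m P μ) :
    0 < biasConst m (fun x => P.eval x) μ := by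
  have hpow := h.integral_mul_of_monic (Polynomial.monic_X_pow m) (Polynomial.natDegree_X_pow m)
  simp only [Polynomial.eval_pow, Polynomial.eval_X] at hpow
  rw [biasConst, hpow]
  exact mul_pos (by positivity) h.sq_pos

lemma le_card_oddRoots (h : IsOrthogonalPolynomial m P μ) : m ≤ (oddRoots P).card := by
  by_contra! hlt
  set N := Lagrange.nodal (oddRoots P) id
  have hNdeg : N.degree < m := by rw [Lagrange.degree_nodal]; exact_mod_cast hlt
  have hint : Integrable (fun x => (P * N).eval x) μ := by
    simpa only [Polynomial.eval_mul] using
      h.integrable_mul (Polynomial.natDegree_le_of_degree_le hNdeg.le)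
  have hzero : ∫ x, (P * N).eval x ∂μ = 0 := by
    simpa only [Polynomial.eval_mul] using h.orthogonal N hNdeg
  have hae : ∀ᵐ x ∂μ, (P * N).eval x = 0 := by
    rcases nonneg_or_nonpos_mul_nodal_oddRoots P with hsign | hsign
    · exact (integral_eq_zero_iff_of_nonneg hsign hint).1 hzero
    · have hneg : ∫ x, -(P * N).eval x ∂μ = 0 := by rw [integral_neg, hzero, neg_zero]
      filter_upwards [(integral_eq_zero_iff_of_nonneg (fun x => neg_nonneg.2 (hsign x))
        hint.neg).1 hneg] with x hx using neg_eq_zero.1 hx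
  have hP : ∀ᵐ x ∂μ, P.eval x ^ 2 = 0 := by
    filter_upwards [hae] with x hx
    rw [Polynomial.eval_mul] at hx
    have hroot : P.eval x = 0 := (mul_eq_zero.1 hx).elim id fun hN =>
      Polynomial.eval_eq_zero_of_dvd_of_eval_eq_zero (nodal_oddRoots_dvd h.monic.ne_zero) hN
    rw [hroot, zero_pow two_ne_zero]
  exact h.sq_pos.ne' (integral_eq_zero_of_ae hP)

lemma exists_eq_nodal (h : IsOrthogonalPolynomial m P μ) :
    ∃ r : Fin m → ℝ, Function.Injective r ∧ P = Lagrange.nodal Finset.univ r := by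
  have hP : P = Lagrange.nodal (oddRoots P) id :=
    Polynomial.eq_of_monic_of_dvd_of_natDegree_le (Lagrange.nodal_monic) h.monic
      (nodal_oddRoots_dvd h.monic.ne_zero)
      (by rw [Lagrange.natDegree_nodal, h.natDegree_eq]; exact h.le_card_oddRoots)
  have hcard : (oddRoots P).card = m := by
    rw [← h.natDegree_eq, ← Lagrange.natDegree_nodal (v := (id : ℝ → ℝ)), ← hP]
  refine ⟨(oddRoots P).orderEmbOfFin hcard, ((oddRoots P).orderEmbOfFin hcard).injective, ?_⟩
  conv_lhs => rw [hP, ← Finset.map_orderEmbOfFin_univ (oddRoots P) hcard]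
  exact Finset.prod_map _ _ _

end IsOrthogonalPolynomial

/-! ### Existence of biased distributions -/

section Existence

variable {m : ℕ} {P : ℝ[X]} {μ : Measure ℝ}

lemma measurable_fin_cons (r : Fin m → ℝ) :
    Measurable (fun x : ℝ => (Fin.cons x r : Fin (m + 1) → ℝ)) :=
  measurable_pi_lambda _ (Fin.cases measurable_id fun _ => measurable_const)

/-- The measure `E[P(X)² K(X, ·)]`, `X ∼ μ`, where `K(x, ·)` is the Hermite–Genocchi kernel at the
nodes `x, r 0, …, r (m - 1)`. If the nodes `r` are the zeros of the orthogonal polynomial `P`, this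
is the biased distribution up to normalization. -/
noncomputable def unnormalizedBias (P : ℝ[X]) (r : Fin m → ℝ) (μ : Measure ℝ) : Measure ℝ :=
  (hermiteGenocchi m).comap (fun x => Fin.cons x r) (measurable_fin_cons r) ∘ₘ
    μ.withDensity fun x => ENNReal.ofReal (P.eval x ^ 2)

lemma integral_iteratedDeriv_unnormalizedBias [SFinite μ] {r : Fin m → ℝ}
    (hr : Function.Injective r) (hroot : ∀ i, P.eval (r i) = 0) {F : ℝ → ℝ}
    (hF : HasMeasurableDeriv m F)
    (hint : Integrable (iteratedDeriv m F) (unnormalizedBias P r μ)) :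
    ∫ y, iteratedDeriv m F y ∂(unnormalizedBias P r μ) =
      ∫ x, P.eval x ^ 2 * dividedDiff (Fin.cons x r) F ∂μ := by
  have hmeas : Measurable fun x => ENNReal.ofReal (P.eval x ^ 2) := by fun_prop
  have hae := ((Measure.integrable_comp_iff hint.1).1 hint).1
  rw [ae_withDensity_iff hmeas] at hae
  rw [unnormalizedBias, integral_measure_comp hint,
    integral_withDensity_eq_integral_toReal_smul hmeas (by simp)]
  refine integral_congr_ae ?_
  filter_upwards [hae] with x hx
  rw [ENNReal.toReal_ofReal (sq_nonneg _), smul_eq_mul]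
  rcases eq_or_ne (P.eval x) 0 with h0 | h0
  · simp only [h0, zero_pow two_ne_zero, zero_mul]
  have hinj : Function.Injective (Fin.cons x r : Fin (m + 1) → ℝ) := by
    refine Fin.cons_injective_iff.2 ⟨?_, hr⟩
    rintro ⟨i, rfl⟩
    exact h0 (hroot i)
  have hint_x := hx (by simpa using h0)
  rw [Kernel.comap_apply] at hint_x ⊢
  rw [integral_iteratedDeriv_hermiteGenocchi hinj hF hint_x]

lemma IsOrthogonalPolynomial.integral_sq_mul_dividedDiff (h : IsOrthogonalPolynomial m P μ)
    {r : Fin m → ℝ} (hr : Function.Injective r) (hP : P = Lagrange.nodal Finset.univ r)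
    {F : ℝ → ℝ} (hint : Integrable (fun x => P.eval x * F x) μ) :
    ∫ x, P.eval x ^ 2 * dividedDiff (Fin.cons x r) F ∂μ = ∫ x, P.eval x * F x ∂μ := by
  set Q := Lagrange.interpolate Finset.univ r (F ∘ r)
  have hdeg : Q.degree < m := by
    simpa only [Finset.card_univ, Fintype.card_fin] using
      Lagrange.degree_interpolate_lt (s := Finset.univ) (F ∘ r) hr.injOn
  have hremainder : ∀ x, P.eval x ^ 2 * dividedDiff (Fin.cons x r) F =
      P.eval x * F x - P.eval x * Q.eval x := fun x => by
    rcases eq_or_ne (P.eval x) 0 with h0 | h0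
    · simp only [h0, zero_pow two_ne_zero, zero_mul, sub_zero]
    have hne : ∀ i, x ≠ r i := fun i hi => h0 (by
      rw [hP, hi, Lagrange.eval_nodal_at_node (Finset.mem_univ i)])
    have hnewton := sub_eval_interpolate_eq_mul_dividedDiff F (Fin.cons x r) hne
    rw [Fin.tail_cons, Fin.cons_zero, ← hP] at hnewton
    rw [← mul_sub, hnewton, sq, mul_assoc]
  simp only [hremainder]
  rw [integral_sub hint (h.integrable_mul (Polynomial.natDegree_le_of_degree_le hdeg.le)),
    h.orthogonal Q hdeg, sub_zero]

theorem IsOrthogonalPolynomial.exists_isBiased [IsFiniteMeasure μ]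
    (h : IsOrthogonalPolynomial m P μ) :
    ∃ ν : Measure ℝ, IsFiniteMeasure ν ∧ IsBiased m (fun x => P.eval x) μ ν := by
  obtain ⟨r, hr, hP⟩ := h.exists_eq_nodal
  have hroot : ∀ i, P.eval (r i) = 0 := fun i => by
    rw [hP, Lagrange.eval_nodal_at_node (Finset.mem_univ i)]
  have hα := h.biasConst_pos
  set α := biasConst m (fun x => P.eval x) μ
  have hfinite : IsFiniteMeasure (μ.withDensity fun x => ENNReal.ofReal (P.eval x ^ 2)) := by
    refine isFiniteMeasure_withDensity_ofReal (Integrable.hasFiniteIntegral ?_)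
    simpa only [sq] using h.integrable_mul h.natDegree_eq.le
  have hfinite' : IsFiniteMeasure (unnormalizedBias P r μ) := by
    unfold unnormalizedBias; infer_instance
  refine ⟨ENNReal.ofReal α⁻¹ • unnormalizedBias P r μ,
    Measure.smul_finite _ ENNReal.ofReal_ne_top, hα, fun F hF hPF hint => ?_⟩
  rw [integrable_smul_measure (by simpa using hα) ENNReal.ofReal_ne_top] at hint
  rw [integral_smul_measure, ENNReal.toReal_ofReal (inv_pos.2 hα).le, smul_eq_mul,
    mul_inv_cancel_left₀ hα.ne', integral_iteratedDeriv_unnormalizedBias hr hroot hF hint,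
    h.integral_sq_mul_dividedDiff hr hP hPF]

end Existence

/-! ### Characteristic functions of biased distributions -/

section CharFun

variable {m : ℕ}

lemma iteratedDeriv_continuousLinearMap_comp {E F : Type*} [NormedAddCommGroup E]
    [NormedSpace ℝ E] [NormedAddCommGroup F] [NormedSpace ℝ F] (φ : E →L[ℝ] F) {f : ℝ → E}
    (hf : ContDiff ℝ m f) :
    iteratedDeriv m (fun x => φ (f x)) = fun x => φ (iteratedDeriv m f x) := by
  funext x
  have h := φ.iteratedFDeriv_comp_left (i := m) hf.contDiffAt (x := x) le_rfl
  simp only [iteratedDeriv_eq_iteratedFDeriv, ← Function.comp_def, h,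
    ContinuousLinearMap.compContinuousMultilinearMap_coe, Function.comp_apply]

lemma hasMeasurableDeriv_of_contDiff {F : ℝ → ℝ} (hF : ContDiff ℝ m F) : HasMeasurableDeriv m F :=
  ⟨fun j hj => hF.differentiable_iteratedDeriv j (by exact_mod_cast hj),
    (hF.continuous_iteratedDeriv m le_rfl).measurable⟩

lemma IsBiased.integral_smul {E : Type*} [NormedAddCommGroup E] [NormedSpace ℝ E]
    [CompleteSpace E] {P : ℝ → ℝ} {μ ν : Measure ℝ} (h : IsBiased m P μ ν) {F : ℝ → E}
    (hF : ContDiff ℝ m F) (hμ : Integrable (fun x => P x • F x) μ)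
    (hν : Integrable (iteratedDeriv m F) ν) :
    ∫ x, P x • F x ∂μ = biasConst m P μ • ∫ y, iteratedDeriv m F y ∂ν := by
  refine (SeparatingDual.eq_iff_forall_dual_eq (R := ℝ)).2 fun φ => ?_
  have hscalar := h.2 (fun x => φ (F x)) (hasMeasurableDeriv_of_contDiff (φ.contDiff.comp hF))
    (by simpa only [map_smul, smul_eq_mul] using φ.integrable_comp hμ)
    (by simpa only [iteratedDeriv_continuousLinearMap_comp φ hF] using φ.integrable_comp hν)
  rw [iteratedDeriv_continuousLinearMap_comp φ hF, φ.integral_comp_comm hν] at hscalar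
  rw [map_smul, smul_eq_mul, ← hscalar, ← φ.integral_comp_comm hμ]
  simp only [map_smul, smul_eq_mul]

lemma iteratedDeriv_cexp_ofReal_mul (z : ℂ) (k : ℕ) :
    iteratedDeriv k (fun x : ℝ => Complex.exp (x * z)) =
      fun x : ℝ => z ^ k * Complex.exp (x * z) := by
  induction k with
  | zero => simp
  | succ k ih =>
    funext x
    have hexp : HasDerivAt (fun x : ℝ => Complex.exp (x * z)) (Complex.exp (x * z) * z) x := by
      simpa using (((hasDerivAt_id x).ofReal_comp).mul_const z).cexp
    rw [iteratedDeriv_succ, ih, (hexp.const_mul (z ^ k)).deriv]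
    ring

lemma integrable_mul_cexp {μ : Measure ℝ} {f : ℝ → ℝ} (hf : Integrable f μ) (t : ℝ) :
    Integrable (fun x : ℝ => (f x : ℂ) * Complex.exp (t * x * Complex.I)) μ := by
  refine hf.ofReal.mul_bdd (c := 1) (by fun_prop) (Filter.Eventually.of_forall fun x => ?_)
  rw [← Complex.ofReal_mul, Complex.norm_exp_ofReal_mul_I]

lemma IsBiased.integral_mul_cexp {P : ℝ → ℝ} {μ ν : Measure ℝ} [IsFiniteMeasure ν]
    (h : IsBiased m P μ ν) (hP : Integrable P μ) (t : ℝ) :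
    ∫ x, (P x : ℂ) * Complex.exp (t * x * Complex.I) ∂μ =
      biasConst m P μ * (t * Complex.I) ^ m * charFun ν t := by
  have hcexp : ∀ x : ℝ, Complex.exp (t * x * Complex.I) = Complex.exp (x * (t * Complex.I)) :=
    fun x => by rw [mul_left_comm, mul_assoc]
  have hμ := integrable_mul_cexp hP t
  have hν := integrable_mul_cexp (integrable_const (μ := ν) (1 : ℝ)) t
  simp only [hcexp, Complex.ofReal_one, one_mul] at hμ hν
  have hF : ContDiff ℝ m fun x : ℝ => Complex.exp (x * (t * Complex.I)) :=
    (Complex.ofRealCLM.contDiff.mul contDiff_const).cexp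
  have hbias := h.integral_smul hF (by simpa only [Complex.real_smul] using hμ)
    (by simpa only [iteratedDeriv_cexp_ofReal_mul] using hν.const_mul _)
  simp only [iteratedDeriv_cexp_ofReal_mul, integral_const_mul, Complex.real_smul] at hbias
  simp only [charFun_apply_real, hcexp]
  rw [hbias, mul_assoc]

lemma IsOrthogonalPolynomial.isBiased_of_charFun {P : ℝ[X]} {μ ν : Measure ℝ}
    [IsFiniteMeasure μ] [IsFiniteMeasure ν] (h : IsOrthogonalPolynomial m P μ)
    (hν : ∀ t : ℝ, ∫ x, ((P.eval x : ℝ) : ℂ) * Complex.exp (t * x * Complex.I) ∂μ =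
      biasConst m (fun x => P.eval x) μ * (t * Complex.I) ^ m * charFun ν t) :
    IsBiased m (fun x => P.eval x) μ ν := by
  obtain ⟨ν', hfinite, hν'⟩ := h.exists_isBiased
  suffices hcf : charFun ν = charFun ν' by rwa [Measure.ext_of_charFun hcf]
  refine Continuous.ext_on (dense_compl_singleton (0 : ℝ)) continuous_charFun continuous_charFun
    fun t ht => ?_
  have hα : (biasConst m (fun x => P.eval x) μ : ℂ) ≠ 0 := by exact_mod_cast hν'.1.ne'
  have htI : (t * Complex.I : ℂ) ≠ 0 := mul_ne_zero (by exact_mod_cast ht) Complex.I_ne_zero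
  exact mul_left_cancel₀ (mul_ne_zero hα (pow_ne_zero m htI))
    ((hν t).symm.trans (hν'.integral_mul_cexp h.integrable t))

end CharFun

/-! ### Orthogonal families and matching moments -/

section MomentsMatch

variable {m k : ℕ} {ρ μ : Measure ℝ} {P : ℝ[X]}

lemma MomentsMatch.mono (h : MomentsMatch m ρ μ) (hk : k ≤ m) : MomentsMatch k ρ μ :=
  fun j hj => h j (hj.trans (Nat.mul_le_mul_left 2 hk))

lemma MomentsMatch.integral_eval (h : MomentsMatch m ρ μ)
    (hρ : ∀ j ≤ 2 * m, Integrable (fun x : ℝ => x ^ j) ρ) (hP : P.natDegree ≤ 2 * m) :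
    ∫ x, P.eval x ∂μ = ∫ x, P.eval x ∂ρ := by
  have hle : ∀ j ∈ Finset.range (P.natDegree + 1), j ≤ 2 * m := fun j hj =>
    (Finset.mem_range_succ_iff.1 hj).trans hP
  simp only [Polynomial.eval_eq_sum_range]
  rw [integral_finsetSum _ fun j hj => (h j (hle j hj)).1.const_mul _,
    integral_finsetSum _ fun j hj => (hρ j (hle j hj)).const_mul _]
  refine Finset.sum_congr rfl fun j hj => ?_
  rw [integral_const_mul, integral_const_mul, (h j (hle j hj)).2]

namespace IsOrthogonalPolynomial

lemma integral_mul_eq_of_momentsMatch (hP : IsOrthogonalPolynomial m P ρ)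
    (h : MomentsMatch m ρ μ) {Q : ℝ[X]} (hQ : Q.natDegree ≤ m) :
    ∫ x, P.eval x * Q.eval x ∂μ = ∫ x, P.eval x * Q.eval x ∂ρ := by
  have hdeg : (P * Q).natDegree ≤ 2 * m :=
    Polynomial.natDegree_mul_le.trans (by rw [hP.natDegree_eq]; lia)
  simpa only [Polynomial.eval_mul] using h.integral_eval hP.integrable_pow hdeg

lemma of_momentsMatch (hP : IsOrthogonalPolynomial m P ρ) (h : MomentsMatch m ρ μ) :
    IsOrthogonalPolynomial m P μ where
  monic := hP.monic
  natDegree_eq := hP.natDegree_eq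
  integrable_pow j hj := (h j hj).1
  orthogonal Q hQ := by
    rw [hP.integral_mul_eq_of_momentsMatch h (Polynomial.natDegree_le_of_degree_le hQ.le),
      hP.orthogonal Q hQ]
  sq_pos := by
    simpa only [sq, hP.integral_mul_eq_of_momentsMatch h hP.natDegree_eq.le] using hP.sq_pos

lemma biasConst_eq_of_momentsMatch (hP : IsOrthogonalPolynomial m P ρ) (h : MomentsMatch m ρ μ) :
    biasConst m (fun x => P.eval x) μ = biasConst m (fun x => P.eval x) ρ := by
  have hpow := hP.integral_mul_eq_of_momentsMatch h (Polynomial.natDegree_X_pow m).le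
  simp only [Polynomial.eval_pow, Polynomial.eval_X] at hpow
  rw [biasConst, biasConst, hpow]

end IsOrthogonalPolynomial

end MomentsMatch

lemma degree_sub_C_coeff_mul_lt {R p : ℝ[X]} {d : ℕ} (hR : R.degree < d + 1)
    (hp : p.Monic) (hpd : p.natDegree = d) :
    (R - Polynomial.C (R.coeff d) * p).degree < d := by
  rw [Polynomial.degree_lt_iff_coeff_zero]
  intro j hj
  rw [Polynomial.coeff_sub, Polynomial.coeff_C_mul]
  rcases hj.eq_or_lt with rfl | hlt
  · have : p.coeff d = 1 := by rw [← hpd, hp.coeff_natDegree]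
    rw [this, mul_one, sub_self]
  · rw [Polynomial.coeff_eq_zero_of_degree_lt (hR.trans_le (by exact_mod_cast hlt)),
      Polynomial.coeff_eq_zero_of_natDegree_lt (hpd.trans_lt hlt), mul_zero, sub_zero]

namespace IsMonicOrthogonal

variable {m : ℕ} {μ : Measure ℝ} {p : ℕ → ℝ[X]}

lemma integral_mul_eq_zero (h : IsMonicOrthogonal m μ p)
    (hμ : ∀ j ≤ 2 * m, Integrable (fun x : ℝ => x ^ j) μ) {k : ℕ} (hk : k ≤ m) {R : ℝ[X]} {d : ℕ}
    (hd : d ≤ k) (hR : R.degree < d) : ∫ x, (p k).eval x * R.eval x ∂μ = 0 := by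
  induction d generalizing R with
  | zero =>
    obtain rfl : R = 0 := by simpa using hR
    simp only [Polynomial.eval_zero, mul_zero, integral_zero]
  | succ d ih =>
    have hdm : d ≤ m := by lia
    set S := R - Polynomial.C (R.coeff d) * p d with hS
    have hSd : S.degree < d :=
      degree_sub_C_coeff_mul_lt hR (h.monic d hdm) (h.natDegree_eq d hdm)
    have hint : ∀ Q : ℝ[X], Q.natDegree ≤ m → Integrable (fun x => (p k).eval x * Q.eval x) μ :=
      fun Q hQ => integrable_eval_mul_eval hμ ((h.natDegree_eq k hk).trans_le hk) hQ
    have hsplit : ∀ x, (p k).eval x * R.eval x =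
        (p k).eval x * S.eval x + R.coeff d * ((p k).eval x * (p d).eval x) := fun x => by
      simp only [hS, Polynomial.eval_sub, Polynomial.eval_mul, Polynomial.eval_C]
      ring
    simp only [hsplit]
    rw [integral_add (hint S ((Polynomial.natDegree_le_of_degree_le hSd.le).trans hdm))
        ((hint (p d) ((h.natDegree_eq d hdm).trans_le hdm)).const_mul _),
      ih (by lia) hSd, integral_const_mul, h.orthogonal k hk d hdm (by lia), mul_zero, add_zero]

lemma isOrthogonalPolynomial (h : IsMonicOrthogonal m μ p)
    (hμ : ∀ j ≤ 2 * m, Integrable (fun x : ℝ => x ^ j) μ) {k : ℕ} (hk : k ≤ m) :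
    IsOrthogonalPolynomial k (p k) μ where
  monic := h.monic k hk
  natDegree_eq := h.natDegree_eq k hk
  integrable_pow j hj := hμ j (by lia)
  orthogonal _ hR := h.integral_mul_eq_zero hμ hk le_rfl hR
  sq_pos := h.sq_pos k hk

end IsMonicOrthogonal

/-! ### Sums of independent variables -/

/-- The law of the sum of independent variables with laws `ρ i`. -/
noncomputable def sumLaw {ι : Type*} [Fintype ι] (ρ : ι → Measure ℝ) : Measure ℝ :=
  (Measure.pi ρ).map fun x => ∑ i, x i

/-- The product, over the coordinates of the multi-index `k`, of the normalizing constants of the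
polynomials `p i (k i)`. -/
noncomputable def prodBiasConst {ι : Type*} [Fintype ι] (p : ι → ℕ → ℝ[X]) (ρ : ι → Measure ℝ)
    (k : ι → ℕ) : ℝ :=
  ∏ i, biasConst (k i) (fun x => (p i (k i)).eval x) (ρ i)

/-- The polynomial `Q` of a sum expands in products of the polynomials `p i j` of total degree `m`,
with coefficients `c`. -/
def HasSumExpansion {ι : Type*} [Fintype ι] [DecidableEq ι] (m : ℕ) (Q : ℝ[X])
    (p : ι → ℕ → ℝ[X]) (c : (ι → ℕ) → ℝ) : Prop :=
  ∀ x : ι → ℝ, Q.eval (∑ i, x i) =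
    ∑ k ∈ Finset.piAntidiag Finset.univ m, c k * ∏ i, (p i (k i)).eval (x i)

section MultiIndex

variable {ι : Type*} [Fintype ι] [DecidableEq ι] {m : ℕ} {k : ι → ℕ}

lemma sum_eq_of_mem_piAntidiag (hk : k ∈ Finset.piAntidiag Finset.univ m) : ∑ i, k i = m :=
  (Finset.mem_piAntidiag.1 hk).1

lemma le_of_mem_piAntidiag (hk : k ∈ Finset.piAntidiag Finset.univ m) (i : ι) : k i ≤ m :=
  (Finset.single_le_sum_of_canonicallyOrdered (Finset.mem_univ i)).trans_eq
    (sum_eq_of_mem_piAntidiag hk)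

end MultiIndex

lemma exists_lt_of_sum_le_of_ne {ι : Type*} [Fintype ι] {j k : ι → ℕ}
    (hsum : ∑ i, j i ≤ ∑ i, k i) (hne : j ≠ k) : ∃ i, j i < k i := by
  by_contra! hle
  have hlt : k < j := lt_of_le_of_ne hle hne.symm
  exact hsum.not_gt (Fintype.sum_strictMono hlt)

section SumLaw

variable {ι : Type*} [Fintype ι] {ρ : ι → Measure ℝ}

instance [∀ i, IsFiniteMeasure (ρ i)] : IsFiniteMeasure (sumLaw ρ) := by
  unfold sumLaw; infer_instance

lemma integral_sumLaw {E : Type*} [NormedAddCommGroup E] [NormedSpace ℝ E]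
    [SecondCountableTopology E] {f : ℝ → E} (hf : Continuous f) :
    ∫ y, f y ∂(sumLaw ρ) = ∫ x, f (∑ i, x i) ∂(Measure.pi ρ) :=
  integral_map (by fun_prop) hf.aestronglyMeasurable

lemma sum_pow_mul_prod [DecidableEq ι] (x g : ι → ℝ) (d : ℕ) :
    (∑ i, x i) ^ d * ∏ i, g i = ∑ j ∈ Finset.piAntidiag Finset.univ d,
      (Nat.multinomial Finset.univ j : ℝ) * ∏ i, (g i * x i ^ j i) := by
  rw [Finset.sum_pow_eq_sum_piAntidiag, Finset.sum_mul]
  refine Finset.sum_congr rfl fun j _ => ?_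
  rw [Finset.prod_mul_distrib, mul_assoc, mul_comm (∏ i, g i)]

variable [∀ i, SigmaFinite (ρ i)] {g : ι → ℝ → ℝ} {d : ℕ}

lemma integrable_multinomial_mul_prod [DecidableEq ι]
    (hg : ∀ i, ∀ j ≤ d, Integrable (fun x => g i x * x ^ j) (ρ i)) :
    ∀ j ∈ Finset.piAntidiag (Finset.univ : Finset ι) d,
      Integrable (fun x : ι → ℝ => (Nat.multinomial Finset.univ j : ℝ) *
        ∏ i, (g i (x i) * x i ^ j i)) (Measure.pi ρ) := fun j hj =>
  (Integrable.fintype_prod_dep fun i => hg i (j i) (le_of_mem_piAntidiag hj i)).const_mul _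

lemma integrable_sum_pow_mul_prod
    (hg : ∀ i, ∀ j ≤ d, Integrable (fun x => g i x * x ^ j) (ρ i)) :
    Integrable (fun x : ι → ℝ => (∑ i, x i) ^ d * ∏ i, g i (x i)) (Measure.pi ρ) := by
  classical
  simp only [fun x : ι → ℝ => sum_pow_mul_prod x (fun i => g i (x i))]
  exact integrable_finsetSum _ (integrable_multinomial_mul_prod hg)

lemma integral_sum_pow_mul_prod [DecidableEq ι]
    (hg : ∀ i, ∀ j ≤ d, Integrable (fun x => g i x * x ^ j) (ρ i)) :
    ∫ x : ι → ℝ, (∑ i, x i) ^ d * ∏ i, g i (x i) ∂(Measure.pi ρ) =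
      ∑ j ∈ Finset.piAntidiag Finset.univ d,
        (Nat.multinomial Finset.univ j : ℝ) * ∏ i, ∫ x, g i x * x ^ j i ∂(ρ i) := by
  simp only [fun x : ι → ℝ => sum_pow_mul_prod x (fun i => g i (x i))]
  rw [integral_finsetSum _ (integrable_multinomial_mul_prod hg)]
  refine Finset.sum_congr rfl fun j _ => ?_
  rw [integral_const_mul, integral_fintype_prod_eq_prod fun i x => g i x * x ^ j i]

lemma integrable_pow_sumLaw (hρ : ∀ i, ∀ j ≤ d, Integrable (fun x : ℝ => x ^ j) (ρ i)) :
    Integrable (fun x : ℝ => x ^ d) (sumLaw ρ) := by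
  rw [sumLaw, integrable_map_measure (by fun_prop) (by fun_prop)]
  simpa only [Finset.prod_const_one, mul_one, Function.comp_def] using
    integrable_sum_pow_mul_prod (g := fun _ _ => 1) (by simpa only [one_mul] using hρ)

end SumLaw

lemma integrable_eval_mul_pow {m : ℕ} {p : ℕ → ℝ[X]} {μ : Measure ℝ}
    (hp : ∀ j ≤ m, IsOrthogonalPolynomial j (p j) μ) {j d : ℕ} (hj : j ≤ m) (hd : d ≤ m) :
    Integrable (fun x => (p j).eval x * x ^ d) μ := by
  simpa only [Polynomial.eval_pow, Polynomial.eval_X] using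
    integrable_eval_mul_eval (hp m le_rfl).integrable_pow ((hp j hj).natDegree_eq.trans_le hj)
      ((Polynomial.natDegree_X_pow d).trans_le hd)

lemma eval_sum_mul_prod {ι : Type*} [Fintype ι] {m : ℕ} {R : ℝ[X]} (hR : R.natDegree ≤ m)
    (x g : ι → ℝ) :
    R.eval (∑ i, x i) * ∏ i, g i =
      ∑ d ∈ Finset.range (m + 1), R.coeff d * ((∑ i, x i) ^ d * ∏ i, g i) := by
  rw [Polynomial.eval_eq_sum_range' (Nat.lt_succ_of_le hR), Finset.sum_mul]
  simp only [mul_assoc]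

section Pairing

variable {ι : Type*} [Fintype ι] [DecidableEq ι] {m : ℕ} {ρ : ι → Measure ℝ}
  {p : ι → ℕ → ℝ[X]} {k : ι → ℕ}

lemma prod_integral_eval_mul_pow_eq_zero
    (hp : ∀ i, ∀ j ≤ m, IsOrthogonalPolynomial j (p i j) (ρ i))
    (hk : k ∈ Finset.piAntidiag Finset.univ m) {j : ι → ℕ} (hj : ∑ i, j i ≤ m) (hne : j ≠ k) :
    ∏ i, ∫ x, (p i (k i)).eval x * x ^ j i ∂(ρ i) = 0 := by
  obtain ⟨i, hi⟩ := exists_lt_of_sum_le_of_ne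
    (hj.trans_eq (sum_eq_of_mem_piAntidiag hk).symm) hne
  refine Finset.prod_eq_zero (Finset.mem_univ i) ?_
  simpa only [Polynomial.eval_pow, Polynomial.eval_X] using
    (hp i _ (le_of_mem_piAntidiag hk i)).orthogonal (Polynomial.X ^ j i)
      (by rw [Polynomial.degree_X_pow]; exact_mod_cast hi)

lemma multinomial_mul_prod_integral_eval_mul_pow (hk : k ∈ Finset.piAntidiag Finset.univ m) :
    (Nat.multinomial Finset.univ k : ℝ) * ∏ i, ∫ x, (p i (k i)).eval x * x ^ k i ∂(ρ i) =
      m.factorial * prodBiasConst p ρ k := by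
  have hspec : ((∏ i, (k i).factorial : ℕ) : ℝ) * Nat.multinomial Finset.univ k = m.factorial := by
    rw [← sum_eq_of_mem_piAntidiag hk]
    exact_mod_cast Nat.multinomial_spec Finset.univ k
  have hfactorial : (∏ i, ((k i).factorial : ℝ)) ≠ 0 :=
    Finset.prod_ne_zero_iff.2 fun i _ => by positivity
  simp only [prodBiasConst, biasConst, Finset.prod_mul_distrib, Finset.prod_inv_distrib, ← hspec]
  push_cast
  field_simp

lemma prodBiasConst_pos (hp : ∀ i, ∀ j ≤ m, IsOrthogonalPolynomial j (p i j) (ρ i))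
    (hk : k ∈ Finset.piAntidiag Finset.univ m) : 0 < prodBiasConst p ρ k :=
  Finset.prod_pos fun i _ => (hp i _ (le_of_mem_piAntidiag hk i)).biasConst_pos

variable [∀ i, SigmaFinite (ρ i)]

lemma integral_sum_pow_mul_prod_eval (hp : ∀ i, ∀ j ≤ m, IsOrthogonalPolynomial j (p i j) (ρ i))
    (hk : k ∈ Finset.piAntidiag Finset.univ m) {d : ℕ} (hd : d ≤ m) :
    ∫ x : ι → ℝ, (∑ i, x i) ^ d * ∏ i, (p i (k i)).eval (x i) ∂(Measure.pi ρ) =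
      if d = m then m.factorial * prodBiasConst p ρ k else 0 := by
  rw [integral_sum_pow_mul_prod (g := fun i x => (p i (k i)).eval x) fun i _ hj =>
    integrable_eval_mul_pow (hp i) (le_of_mem_piAntidiag hk i) (hj.trans hd)]
  have hvanish : ∀ j ∈ Finset.piAntidiag Finset.univ d, j ≠ k →
      (Nat.multinomial Finset.univ j : ℝ) *
        ∏ i, ∫ x, (p i (k i)).eval x * x ^ j i ∂(ρ i) = 0 := fun j hj hne => by
    rw [prod_integral_eval_mul_pow_eq_zero hp hk ((sum_eq_of_mem_piAntidiag hj).trans_le hd) hne,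
      mul_zero]
  split_ifs with hdm
  · subst hdm
    rw [Finset.sum_eq_single_of_mem k hk hvanish, multinomial_mul_prod_integral_eval_mul_pow hk]
  · refine Finset.sum_eq_zero fun j hj => hvanish j hj ?_
    rintro rfl
    exact hdm ((sum_eq_of_mem_piAntidiag hj).symm.trans (sum_eq_of_mem_piAntidiag hk))

variable {R : ℝ[X]}

lemma integrable_coeff_mul_sum_pow_mul_prod_eval
    (hp : ∀ i, ∀ j ≤ m, IsOrthogonalPolynomial j (p i j) (ρ i))
    (hk : k ∈ Finset.piAntidiag Finset.univ m) : ∀ d ∈ Finset.range (m + 1),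
      Integrable (fun x : ι → ℝ => R.coeff d * ((∑ i, x i) ^ d * ∏ i, (p i (k i)).eval (x i)))
        (Measure.pi ρ) := fun _ hd =>
  (integrable_sum_pow_mul_prod (g := fun i x => (p i (k i)).eval x) fun i _ hj =>
    integrable_eval_mul_pow (hp i) (le_of_mem_piAntidiag hk i)
      (hj.trans (Finset.mem_range_succ_iff.1 hd))).const_mul _

lemma integrable_eval_sum_mul_prod_eval
    (hp : ∀ i, ∀ j ≤ m, IsOrthogonalPolynomial j (p i j) (ρ i))
    (hk : k ∈ Finset.piAntidiag Finset.univ m) (hR : R.natDegree ≤ m) :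
    Integrable (fun x : ι → ℝ => R.eval (∑ i, x i) * ∏ i, (p i (k i)).eval (x i))
      (Measure.pi ρ) := by
  simp only [fun x : ι → ℝ => eval_sum_mul_prod hR x fun i => (p i (k i)).eval (x i)]
  exact integrable_finsetSum _ (integrable_coeff_mul_sum_pow_mul_prod_eval hp hk)

lemma integral_eval_sum_mul_prod_eval
    (hp : ∀ i, ∀ j ≤ m, IsOrthogonalPolynomial j (p i j) (ρ i))
    (hk : k ∈ Finset.piAntidiag Finset.univ m) (hR : R.natDegree ≤ m) :
    ∫ x : ι → ℝ, R.eval (∑ i, x i) * ∏ i, (p i (k i)).eval (x i) ∂(Measure.pi ρ) =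
      m.factorial * R.coeff m * prodBiasConst p ρ k := by
  simp only [fun x : ι → ℝ => eval_sum_mul_prod hR x fun i => (p i (k i)).eval (x i)]
  rw [integral_finsetSum _ (integrable_coeff_mul_sum_pow_mul_prod_eval hp hk),
    Finset.sum_eq_single_of_mem m (Finset.self_mem_range_succ m)]
  · rw [integral_const_mul, integral_sum_pow_mul_prod_eval hp hk le_rfl, if_pos rfl]
    ring
  · intro d hd hdm
    rw [integral_const_mul, integral_sum_pow_mul_prod_eval hp hk (Finset.mem_range_succ_iff.1 hd),
      if_neg hdm, mul_zero]

end Pairing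

namespace HasSumExpansion

variable {ι : Type*} [Fintype ι] [DecidableEq ι] {m : ℕ} {ρ : ι → Measure ℝ}
  [∀ i, IsFiniteMeasure (ρ i)] {p : ι → ℕ → ℝ[X]} {Q : ℝ[X]} {c : (ι → ℕ) → ℝ}

lemma integral_mul (h : HasSumExpansion m Q p c)
    (hp : ∀ i, ∀ j ≤ m, IsOrthogonalPolynomial j (p i j) (ρ i)) {R : ℝ[X]} (hR : R.natDegree ≤ m) :
    ∫ x, Q.eval x * R.eval x ∂(sumLaw ρ) = m.factorial * R.coeff m *
      ∑ k ∈ Finset.piAntidiag Finset.univ m, c k * prodBiasConst p ρ k := by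
  have hexpand : ∀ x : ι → ℝ, Q.eval (∑ i, x i) * R.eval (∑ i, x i) =
      ∑ k ∈ Finset.piAntidiag Finset.univ m,
        c k * (R.eval (∑ i, x i) * ∏ i, (p i (k i)).eval (x i)) := fun x => by
    rw [h x, Finset.sum_mul]
    exact Finset.sum_congr rfl fun k _ => by ring
  rw [integral_sumLaw (by fun_prop)]
  simp only [hexpand]
  rw [integral_finsetSum _ fun k hk => (integrable_eval_sum_mul_prod_eval hp hk hR).const_mul _,
    Finset.mul_sum]
  refine Finset.sum_congr rfl fun k hk => ?_
  rw [integral_const_mul, integral_eval_sum_mul_prod_eval hp hk hR]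
  ring

lemma biasConst_eq_sum (h : HasSumExpansion m Q p c)
    (hp : ∀ i, ∀ j ≤ m, IsOrthogonalPolynomial j (p i j) (ρ i)) :
    biasConst m (fun x => Q.eval x) (sumLaw ρ) =
      ∑ k ∈ Finset.piAntidiag Finset.univ m, c k * prodBiasConst p ρ k := by
  have hpow := h.integral_mul hp (R := Polynomial.X ^ m) (Polynomial.natDegree_X_pow m).le
  simp only [Polynomial.eval_pow, Polynomial.eval_X, Polynomial.coeff_X_pow_self, mul_one] at hpow
  rw [biasConst, hpow, inv_mul_cancel_left₀ (by positivity)]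

lemma integral_mul_prod_eval (h : HasSumExpansion m Q p c)
    (hp : ∀ i, ∀ j ≤ m, IsOrthogonalPolynomial j (p i j) (ρ i)) {k : ι → ℕ}
    (hk : k ∈ Finset.piAntidiag Finset.univ m) :
    ∫ x : ι → ℝ, Q.eval (∑ i, x i) * ∏ i, (p i (k i)).eval (x i) ∂(Measure.pi ρ) =
      c k * ∏ i, ∫ x, (p i (k i)).eval x ^ 2 ∂(ρ i) := by
  have hexpand : ∀ x : ι → ℝ, Q.eval (∑ i, x i) * ∏ i, (p i (k i)).eval (x i) =
      ∑ l ∈ Finset.piAntidiag Finset.univ m,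
        c l * ∏ i, (p i (k i)).eval (x i) * (p i (l i)).eval (x i) := fun x => by
    rw [h x, Finset.sum_mul]
    refine Finset.sum_congr rfl fun l _ => ?_
    rw [Finset.prod_mul_distrib]
    ring
  have hdeg : ∀ {l : ι → ℕ}, l ∈ Finset.piAntidiag (Finset.univ : Finset ι) m → ∀ i,
      (p i (l i)).natDegree ≤ m := fun hl i =>
    (hp i _ (le_of_mem_piAntidiag hl i)).natDegree_eq.trans_le (le_of_mem_piAntidiag hl i)
  have hfactor : ∀ l : ι → ℕ,
      ∫ x : ι → ℝ, ∏ i, (p i (k i)).eval (x i) * (p i (l i)).eval (x i) ∂(Measure.pi ρ) =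
        ∏ i, ∫ x, (p i (k i)).eval x * (p i (l i)).eval x ∂(ρ i) := fun l =>
    integral_fintype_prod_eq_prod fun i x => (p i (k i)).eval x * (p i (l i)).eval x
  have hint : ∀ l ∈ Finset.piAntidiag (Finset.univ : Finset ι) m, Integrable (fun x : ι → ℝ =>
      c l * ∏ i, (p i (k i)).eval (x i) * (p i (l i)).eval (x i)) (Measure.pi ρ) := fun l hl =>
    (Integrable.fintype_prod_dep (f := fun i x => (p i (k i)).eval x * (p i (l i)).eval x)
      fun i => integrable_eval_mul_eval (hp i m le_rfl).integrable_pow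
        (hdeg hk i) (hdeg hl i)).const_mul _
  simp only [hexpand]
  rw [integral_finsetSum _ hint, Finset.sum_eq_single_of_mem k hk]
  · rw [integral_const_mul, hfactor]
    simp only [sq]
  · intro l hl hlk
    obtain ⟨i, hi⟩ := exists_lt_of_sum_le_of_ne
      ((sum_eq_of_mem_piAntidiag hl).trans (sum_eq_of_mem_piAntidiag hk).symm).le hlk
    rw [integral_const_mul, hfactor, Finset.prod_eq_zero (Finset.mem_univ i), mul_zero]
    refine (hp i _ (le_of_mem_piAntidiag hk i)).orthogonal _
      (Polynomial.degree_le_natDegree.trans_lt ?_)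
    rw [(hp i _ (le_of_mem_piAntidiag hl i)).natDegree_eq]
    exact_mod_cast hi

lemma coeff_eq_multinomial (h : HasSumExpansion m Q p c)
    (hp : ∀ i, ∀ j ≤ m, IsOrthogonalPolynomial j (p i j) (ρ i)) (hQ : Q.Monic)
    (hQm : Q.natDegree = m) {k : ι → ℕ} (hk : k ∈ Finset.piAntidiag Finset.univ m) :
    c k = Nat.multinomial Finset.univ k := by
  have hpair := h.integral_mul_prod_eval hp hk
  have hcoeff : Q.coeff m = 1 := by rw [← hQm, hQ.coeff_natDegree]
  have hki := fun i => hp i _ (le_of_mem_piAntidiag hk i)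
  rw [integral_eval_sum_mul_prod_eval hp hk hQm.le, hcoeff, mul_one,
    ← multinomial_mul_prod_integral_eval_mul_pow hk] at hpair
  have hsq : ∀ i, ∫ x, (p i (k i)).eval x * x ^ k i ∂(ρ i) = ∫ x, (p i (k i)).eval x ^ 2 ∂(ρ i) :=
    fun i => by
      simpa only [Polynomial.eval_pow, Polynomial.eval_X] using (hki i).integral_mul_of_monic
        (Polynomial.monic_X_pow (k i)) (Polynomial.natDegree_X_pow (k i))
  simp only [hsq] at hpair
  exact (mul_right_cancel₀ (Finset.prod_pos fun i _ => (hki i).sq_pos).ne' hpair).symm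

lemma coeff_pos (h : HasSumExpansion m Q p c)
    (hp : ∀ i, ∀ j ≤ m, IsOrthogonalPolynomial j (p i j) (ρ i)) (hQ : Q.Monic)
    (hQm : Q.natDegree = m) {k : ι → ℕ} (hk : k ∈ Finset.piAntidiag Finset.univ m) : 0 < c k := by
  rw [h.coeff_eq_multinomial hp hQ hQm hk]
  exact_mod_cast Nat.multinomial_pos Finset.univ k

lemma sum_mul_prodBiasConst_pos [Nonempty ι] (h : HasSumExpansion m Q p c)
    (hp : ∀ i, ∀ j ≤ m, IsOrthogonalPolynomial j (p i j) (ρ i)) (hQ : Q.Monic)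
    (hQm : Q.natDegree = m) :
    0 < ∑ k ∈ Finset.piAntidiag Finset.univ m, c k * prodBiasConst p ρ k :=
  Finset.sum_pos
    (fun _ hk => mul_pos (h.coeff_pos hp hQ hQm hk) (prodBiasConst_pos hp hk))
    ⟨Pi.single (Classical.arbitrary ι) m, by simp [Finset.mem_piAntidiag]⟩

theorem isOrthogonalPolynomial [Nonempty ι] (h : HasSumExpansion m Q p c)
    (hp : ∀ i, ∀ j ≤ m, IsOrthogonalPolynomial j (p i j) (ρ i)) (hQ : Q.Monic)
    (hQm : Q.natDegree = m) : IsOrthogonalPolynomial m Q (sumLaw ρ) where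
  monic := hQ
  natDegree_eq := hQm
  integrable_pow d hd := integrable_pow_sumLaw fun i _ hj =>
    (hp i m le_rfl).integrable_pow _ (hj.trans hd)
  orthogonal R hR := by
    rw [h.integral_mul hp (Polynomial.natDegree_le_of_degree_le hR.le),
      Polynomial.coeff_eq_zero_of_degree_lt hR, mul_zero, zero_mul]
  sq_pos := by
    have hcoeff : Q.coeff m = 1 := by rw [← hQm, hQ.coeff_natDegree]
    simp only [sq]
    rw [h.integral_mul hp hQm.le, hcoeff, mul_one]
    exact mul_pos (by positivity) (h.sum_mul_prodBiasConst_pos hp hQ hQm)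

end HasSumExpansion

/-! ### Biased distributions of sums -/

lemma charFun_sumLaw {ι : Type*} [Fintype ι] (ν : ι → Measure ℝ) [∀ i, IsProbabilityMeasure (ν i)]
    (t : ℝ) : charFun (sumLaw ν) t = ∏ i, charFun (ν i) t := by
  rw [sumLaw, charFun_map_sum_pi_eq_prod, Finset.prod_apply]

lemma charFun_sum_smul {κ : Type*} (S : Finset κ) (w : κ → ENNReal) (hw : ∀ k ∈ S, w k ≠ ⊤)
    (ν : κ → Measure ℝ) [∀ k, IsFiniteMeasure (ν k)] (t : ℝ) :
    charFun (∑ k ∈ S, w k • ν k) t = ∑ k ∈ S, ((w k).toReal : ℂ) * charFun (ν k) t := by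
  have hint : ∀ k, Integrable (fun x : ℝ => Complex.exp (t * x * Complex.I)) (ν k) := fun k => by
    simpa only [Complex.ofReal_one, one_mul] using integrable_mul_cexp (integrable_const 1) t
  simp only [charFun_apply_real]
  rw [integral_finsetSum_measure fun k hk => (hint k).smul_measure (hw k hk)]
  simp only [integral_smul_measure, Complex.real_smul]

lemma prodBiasConst_eq_of_momentsMatch {ι : Type*} [Fintype ι] [DecidableEq ι] {m : ℕ}
    {ρ ξ : ι → Measure ℝ} {p : ι → ℕ → ℝ[X]}
    (hp : ∀ i, ∀ j ≤ m, IsOrthogonalPolynomial j (p i j) (ρ i))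
    (hξ : ∀ i, MomentsMatch m (ρ i) (ξ i)) {k : ι → ℕ}
    (hk : k ∈ Finset.piAntidiag Finset.univ m) : prodBiasConst p ξ k = prodBiasConst p ρ k :=
  Finset.prod_congr rfl fun i _ =>
    (hp i _ (le_of_mem_piAntidiag hk i)).biasConst_eq_of_momentsMatch
      ((hξ i).mono (le_of_mem_piAntidiag hk i))

/-- The probability `p_k` with which the multi-index `k` is chosen in the biased distribution of a
sum of independent variables with laws `ρ i`. -/
noncomputable def biasWeight {ι : Type*} [Fintype ι] (m : ℕ) (Q : ℝ[X]) (p : ι → ℕ → ℝ[X])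
    (c : (ι → ℕ) → ℝ) (ρ : ι → Measure ℝ) (k : ι → ℕ) : ℝ :=
  c k * (prodBiasConst p ρ k / biasConst m (fun x => Q.eval x) (sumLaw ρ))

namespace HasSumExpansion

variable {ι : Type*} [Fintype ι] [DecidableEq ι] {m : ℕ} {ρ : ι → Measure ℝ}
  [∀ i, IsFiniteMeasure (ρ i)] {p : ι → ℕ → ℝ[X]} {Q : ℝ[X]} {c : (ι → ℕ) → ℝ}

lemma biasConst_pos [Nonempty ι] (h : HasSumExpansion m Q p c)
    (hp : ∀ i, ∀ j ≤ m, IsOrthogonalPolynomial j (p i j) (ρ i)) (hQ : Q.Monic)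
    (hQm : Q.natDegree = m) : 0 < biasConst m (fun x => Q.eval x) (sumLaw ρ) :=
  (h.isOrthogonalPolynomial hp hQ hQm).biasConst_pos

lemma biasWeight_nonneg [Nonempty ι] (h : HasSumExpansion m Q p c)
    (hp : ∀ i, ∀ j ≤ m, IsOrthogonalPolynomial j (p i j) (ρ i)) (hQ : Q.Monic)
    (hQm : Q.natDegree = m) {k : ι → ℕ} (hk : k ∈ Finset.piAntidiag Finset.univ m) :
    0 ≤ biasWeight m Q p c ρ k :=
  mul_nonneg (h.coeff_pos hp hQ hQm hk).le
    (div_pos (prodBiasConst_pos hp hk) (h.biasConst_pos hp hQ hQm)).le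

lemma sum_biasWeight [Nonempty ι] (h : HasSumExpansion m Q p c)
    (hp : ∀ i, ∀ j ≤ m, IsOrthogonalPolynomial j (p i j) (ρ i)) (hQ : Q.Monic)
    (hQm : Q.natDegree = m) :
    ∑ k ∈ Finset.piAntidiag Finset.univ m, biasWeight m Q p c ρ k = 1 := by
  simp only [biasWeight, ← mul_div_assoc]
  rw [← Finset.sum_div, ← h.biasConst_eq_sum hp, div_self (h.biasConst_pos hp hQ hQm).ne']

lemma biasWeight_eq_of_momentsMatch (h : HasSumExpansion m Q p c)
    (hp : ∀ i, ∀ j ≤ m, IsOrthogonalPolynomial j (p i j) (ρ i)) {ξ : ι → Measure ℝ}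
    [∀ i, IsFiniteMeasure (ξ i)] (hξ : ∀ i, MomentsMatch m (ρ i) (ξ i)) {k : ι → ℕ}
    (hk : k ∈ Finset.piAntidiag Finset.univ m) :
    biasWeight m Q p c ξ k = biasWeight m Q p c ρ k := by
  have hpξ : ∀ i, ∀ j ≤ m, IsOrthogonalPolynomial j (p i j) (ξ i) := fun i j hj =>
    (hp i j hj).of_momentsMatch ((hξ i).mono hj)
  have hsum : ∑ l ∈ Finset.piAntidiag Finset.univ m, c l * prodBiasConst p ξ l =
      ∑ l ∈ Finset.piAntidiag Finset.univ m, c l * prodBiasConst p ρ l :=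
    Finset.sum_congr rfl fun l hl => by rw [prodBiasConst_eq_of_momentsMatch hp hξ hl]
  rw [biasWeight, biasWeight, prodBiasConst_eq_of_momentsMatch hp hξ hk, h.biasConst_eq_sum hpξ,
    h.biasConst_eq_sum hp, hsum]

lemma eval_sum_mul_cexp (h : HasSumExpansion m Q p c) (t : ℝ) (x : ι → ℝ) :
    ((Q.eval (∑ i, x i) : ℝ) : ℂ) * Complex.exp (t * ((∑ i, x i : ℝ) : ℂ) * Complex.I) =
      ∑ k ∈ Finset.piAntidiag Finset.univ m, (c k : ℂ) *
        ∏ i, ((((p i (k i)).eval (x i) : ℝ) : ℂ) * Complex.exp (t * x i * Complex.I)) := by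
  rw [h x, Complex.ofReal_sum, Finset.sum_mul]
  refine Finset.sum_congr rfl fun k _ => ?_
  rw [Finset.prod_mul_distrib, ← Complex.exp_sum, ← Finset.sum_mul, ← Finset.mul_sum]
  push_cast
  ring

lemma integral_mul_cexp (h : HasSumExpansion m Q p c)
    (hp : ∀ i, ∀ j ≤ m, Integrable (fun x => (p i j).eval x) (ρ i)) (t : ℝ) :
    ∫ x, ((Q.eval x : ℝ) : ℂ) * Complex.exp (t * x * Complex.I) ∂(sumLaw ρ) =
      ∑ k ∈ Finset.piAntidiag Finset.univ m, (c k : ℂ) * ∏ i,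
        ∫ x, (((p i (k i)).eval x : ℝ) : ℂ) * Complex.exp (t * x * Complex.I) ∂(ρ i) := by
  rw [integral_sumLaw (by fun_prop)]
  simp only [h.eval_sum_mul_cexp]
  rw [integral_finsetSum _ fun k hk => (Integrable.fintype_prod_dep fun i =>
    integrable_mul_cexp (hp i _ (le_of_mem_piAntidiag hk i)) t).const_mul _]
  refine Finset.sum_congr rfl fun k _ => ?_
  rw [integral_const_mul, integral_fintype_prod_eq_prod fun i (x : ℝ) =>
    (((p i (k i)).eval x : ℝ) : ℂ) * Complex.exp (t * x * Complex.I)]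

theorem isBiased_sumLaw [Nonempty ι] (h : HasSumExpansion m Q p c)
    (hp : ∀ i, ∀ j ≤ m, IsOrthogonalPolynomial j (p i j) (ρ i)) (hQ : Q.Monic)
    (hQm : Q.natDegree = m) {ν : ι → ℕ → Measure ℝ} [∀ i j, IsProbabilityMeasure (ν i j)]
    (hν : ∀ i, ∀ j ≤ m, IsBiased j (fun x => (p i j).eval x) (ρ i) (ν i j)) :
    IsBiased m (fun x => Q.eval x) (sumLaw ρ)
      (∑ k ∈ Finset.piAntidiag Finset.univ m,
        ENNReal.ofReal (biasWeight m Q p c ρ k) • sumLaw fun i => ν i (k i)) := by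
  have hfinite : ∀ k, IsFiniteMeasure
      (ENNReal.ofReal (biasWeight m Q p c ρ k) • sumLaw fun i => ν i (k i)) := fun k =>
    Measure.smul_finite _ ENNReal.ofReal_ne_top
  refine (h.isOrthogonalPolynomial hp hQ hQm).isBiased_of_charFun fun t => ?_
  rw [h.integral_mul_cexp (fun i j hj => (hp i j hj).integrable),
    charFun_sum_smul _ _ fun _ _ => ENNReal.ofReal_ne_top, Finset.mul_sum]
  refine Finset.sum_congr rfl fun k hk => ?_
  have hfactor : ∀ i,
      ∫ x, (((p i (k i)).eval x : ℝ) : ℂ) * Complex.exp (t * x * Complex.I) ∂(ρ i) =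
        biasConst (k i) (fun x => (p i (k i)).eval x) (ρ i) * (t * Complex.I) ^ k i *
          charFun (ν i (k i)) t := fun i =>
    (hν i _ (le_of_mem_piAntidiag hk i)).integral_mul_cexp
      (hp i _ (le_of_mem_piAntidiag hk i)).integrable t
  have hα : (biasConst m (fun x => Q.eval x) (sumLaw ρ) : ℂ) ≠ 0 := by
    exact_mod_cast (h.biasConst_pos hp hQ hQm).ne'
  rw [ENNReal.toReal_ofReal (h.biasWeight_nonneg hp hQ hQm hk)]
  simp only [hfactor, Finset.prod_mul_distrib, Finset.prod_pow_eq_pow_sum,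
    sum_eq_of_mem_piAntidiag hk, charFun_sumLaw, biasWeight, prodBiasConst]
  push_cast
  field_simp

end HasSumExpansion

/-! ### Random indices -/

section RandomIndex

variable {Ω : Type*} [MeasurableSpace Ω] {μ : Measure Ω}

lemma map_sum_eq_sumLaw {ι : Type*} [Fintype ι] {X : ι → Ω → ℝ} (hX : ∀ i, AEMeasurable (X i) μ)
    (h : iIndepFun X μ) : μ.map (fun ω => ∑ i, X i ω) = sumLaw fun i => μ.map (X i) := by
  have := h.isProbabilityMeasure
  rw [sumLaw, ← (iIndepFun_iff_map_fun_eq_pi_map hX).1 h,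
    AEMeasurable.map_map_of_aemeasurable (by fun_prop) (by fun_prop), Function.comp_def]

variable {κ E : Type*} [MeasurableSpace κ] [MeasurableSingletonClass κ] {I : Ω → κ} {S : Finset κ}

lemma ae_mem_of_sum_measureReal_preimage_singleton_eq_one [IsProbabilityMeasure μ]
    (hI : Measurable I) (hS : ∑ k ∈ S, μ.real (I ⁻¹' {k}) = 1) : ∀ᵐ ω ∂μ, I ω ∈ S := by
  rw [sum_measureReal_preimage_singleton S fun k _ => hI (measurableSet_singleton k),
    measureReal_def, ENNReal.toReal_eq_one_iff] at hS
  exact (mem_ae_iff_prob_eq_one (hI S.measurableSet)).2 hS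

lemma map_random_index_eq_sum [Countable κ] [MeasurableSpace E] {Z : κ → Ω → E}
    (hZ : ∀ k, Measurable (Z k)) (hI : Measurable I) (hIZ : ∀ k, IndepFun I (Z k) μ)
    (hS : ∀ᵐ ω ∂μ, I ω ∈ S) :
    μ.map (fun ω => Z (I ω) ω) = ∑ k ∈ S, μ (I ⁻¹' {k}) • μ.map (Z k) := by
  have hZI : Measurable fun ω => Z (I ω) ω :=
    (measurable_from_prod_countable_right (f := fun x : κ × Ω => Z x.1 x.2) hZ).comp
      (hI.prodMk measurable_id)
  ext A hA
  set B := (fun ω => Z (I ω) ω) ⁻¹' A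
  have hB : μ B = ∑ k ∈ S, μ (I ⁻¹' {k} ∩ B) := by
    have hfull : μ.restrict B (I ⁻¹' S) = μ.restrict B Set.univ :=
      measure_congr (Filter.eventuallyEq_univ.2 (ae_restrict_of_ae hS))
    rw [← Measure.restrict_apply_univ, ← hfull, ← sum_measure_preimage_singleton S
      fun k _ => hI (measurableSet_singleton k)]
    exact Finset.sum_congr rfl fun k _ => Measure.restrict_apply (hI (measurableSet_singleton k))
  have hfiber : ∀ k, I ⁻¹' {k} ∩ B = I ⁻¹' {k} ∩ Z k ⁻¹' A := fun k => by
    ext ω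
    refine and_congr_right fun hω => ?_
    rw [Set.mem_preimage, Set.mem_preimage, Set.mem_singleton_iff.1 hω]
  rw [Measure.map_apply hZI hA, hB, Measure.finsetSum_apply]
  refine Finset.sum_congr rfl fun k _ => ?_
  rw [hfiber, (hIZ k).measure_inter_preimage_eq_mul _ _ (measurableSet_singleton k) hA,
    Measure.smul_apply, Measure.map_apply (hZ k) hA, smul_eq_mul]

lemma map_sum_random_index_eq_sum {ι : Type*} [Fintype ι] {Y : ι → ℕ → Ω → ℝ} {I : Ω → ι → ℕ}
    {S : Finset (ι → ℕ)} [IsProbabilityMeasure μ] (hY : ∀ i k, Measurable (Y i k))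
    (hYind : iIndepFun (fun i ω k => Y i k ω) μ) (hI : Measurable I)
    (hIY : IndepFun I (fun ω i k => Y i k ω) μ) (hS : ∑ k ∈ S, μ.real (I ⁻¹' {k}) = 1) :
    μ.map (fun ω => ∑ i, Y i (I ω i) ω) =
      ∑ k ∈ S, μ (I ⁻¹' {k}) • sumLaw fun i => μ.map (Y i (k i)) := by
  have hIZ : ∀ k : ι → ℕ, IndepFun I (fun ω => ∑ i, Y i (k i) ω) μ := fun k =>
    hIY.comp (ψ := fun y : ι → ℕ → ℝ => ∑ i, y i (k i)) measurable_id (by fun_prop)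
  rw [map_random_index_eq_sum (Z := fun k ω => ∑ i, Y i (k i) ω) (fun k => by fun_prop) hI hIZ
    (ae_mem_of_sum_measureReal_preimage_singleton_eq_one hI hS)]
  refine Finset.sum_congr rfl fun k _ => ?_
  rw [map_sum_eq_sumLaw (fun i => (hY i (k i)).aemeasurable)
    (hYind.comp (fun i y => y (k i)) fun i => measurable_pi_apply _)]

end RandomIndex

lemma ClosedUnderIndepAddition.charFun_sum {L : ℝ → Measure ℝ} (hadd : ClosedUnderIndepAddition L)
    (hprob : ∀ t : ℝ, 0 < t → IsProbabilityMeasure (L t)) {ι : Type*} {lam : ι → ℝ}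
    (hlam : ∀ i, 0 < lam i) {s : Finset ι} (hs : s.Nonempty) (t : ℝ) :
    charFun (L (∑ i ∈ s, lam i)) t = ∏ i ∈ s, charFun (L (lam i)) t := by
  induction hs using Finset.Nonempty.cons_induction with
  | singleton i => simp only [Finset.sum_singleton, Finset.prod_singleton]
  | cons i s his hs ih =>
    have hpos : 0 < ∑ j ∈ s, lam j := Finset.sum_pos (fun j _ => hlam j) hs
    have := hprob _ (hlam i)
    have := hprob _ hpos
    rw [Finset.sum_cons, Finset.prod_cons, ← ih, ← hadd _ _ (hlam i) hpos, charFun_conv]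

lemma ClosedUnderIndepAddition.sumLaw_eq {L : ℝ → Measure ℝ} (hadd : ClosedUnderIndepAddition L)
    (hprob : ∀ t : ℝ, 0 < t → IsProbabilityMeasure (L t)) {ι : Type*} [Fintype ι] [Nonempty ι]
    {lam : ι → ℝ} (hlam : ∀ i, 0 < lam i) : sumLaw (fun i => L (lam i)) = L (∑ i, lam i) := by
  have := fun i => hprob _ (hlam i)
  have := hprob _ (Finset.sum_pos (fun i _ => hlam i) Finset.univ_nonempty)
  refine Measure.ext_of_charFun (funext fun t => ?_)
  rw [charFun_sumLaw, hadd.charFun_sum hprob hlam Finset.univ_nonempty]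

lemma biasConst_eq_alpha (L : ℝ → Measure ℝ) (P : ℝ → ℕ → ℝ[X]) (t : ℝ) (k : ℕ) :
    biasConst k (fun x => (P t k).eval x) (L t) = alpha L P t k := by
  simp only [biasConst, alpha, mul_comm]

theorem theorem3p1_general {ι : Type*} [Fintype ι] [DecidableEq ι] [Nonempty ι] {m : ℕ}
    {ρ : ι → Measure ℝ} [∀ i, IsFiniteMeasure (ρ i)] {p : ι → ℕ → ℝ[X]} {Q : ℝ[X]}
    {c : (ι → ℕ) → ℝ} (hmom : ∀ i, Integrable (fun x : ℝ => x ^ (2 * m)) (ρ i))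
    (hp : ∀ i, IsMonicOrthogonal m (ρ i) (p i)) (hQ : Q.Monic) (hQm : Q.natDegree = m)
    (h : HasSumExpansion m Q p c) :
    biasConst m (fun x => Q.eval x) (sumLaw ρ) =
        ∑ k ∈ Finset.piAntidiag Finset.univ m, c k * prodBiasConst p ρ k ∧
      (∀ k ∈ Finset.piAntidiag Finset.univ m, 0 ≤ biasWeight m Q p c ρ k) ∧
      ∑ k ∈ Finset.piAntidiag Finset.univ m, biasWeight m Q p c ρ k = 1 ∧
      ∀ (Ω : Type*) [MeasurableSpace Ω] (μ : Measure Ω) [IsProbabilityMeasure μ]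
        (X : ι → Ω → ℝ) (Y : ι → ℕ → Ω → ℝ) (I : Ω → ι → ℕ),
        (∀ i, Measurable (X i)) → iIndepFun X μ →
        (∀ i, MomentsMatch m (ρ i) (μ.map (X i))) →
        (∀ i k, Measurable (Y i k)) →
        (∀ i, ∀ k ≤ m, IsBiased k (fun x => (p i k).eval x) (μ.map (X i)) (μ.map (Y i k))) →
        iIndepFun (fun i ω k => Y i k ω) μ →
        Measurable I →
        (∀ k ∈ Finset.piAntidiag Finset.univ m, μ.real (I ⁻¹' {k}) = biasWeight m Q p c ρ k) →
        IndepFun I (fun ω i k => Y i k ω) μ →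
        IsBiased m (fun x => Q.eval x)
          (μ.map (fun ω => ∑ i, X i ω)) (μ.map (fun ω => ∑ i, Y i (I ω i) ω)) := by
  have hop : ∀ i, ∀ j ≤ m, IsOrthogonalPolynomial j (p i j) (ρ i) := fun i _ hj =>
    (hp i).isOrthogonalPolynomial (fun _ => integrable_pow_of_le (hmom i)) hj
  have hsum := h.sum_biasWeight hop hQ hQm
  refine ⟨h.biasConst_eq_sum hop, fun k => h.biasWeight_nonneg hop hQ hQm, hsum, ?_⟩
  intro Ω _ μ _ X Y I hX hXind hXmom hY hbias hYind hI hIw hIY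
  have := fun i => Measure.isProbabilityMeasure_map (hX i).aemeasurable (μ := μ)
  have := fun i k => Measure.isProbabilityMeasure_map (hY i k).aemeasurable (μ := μ)
  have hopX : ∀ i, ∀ j ≤ m, IsOrthogonalPolynomial j (p i j) (μ.map (X i)) := fun i j hj =>
    (hop i j hj).of_momentsMatch ((hXmom i).mono hj)
  rw [map_sum_eq_sumLaw (fun i => (hX i).aemeasurable) hXind,
    map_sum_random_index_eq_sum hY hYind hI hIY ((Finset.sum_congr rfl hIw).trans hsum)]
  convert h.isBiased_sumLaw hopX hQ hQm hbias using 1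
  refine Finset.sum_congr rfl fun k hk => ?_
  rw [h.biasWeight_eq_of_momentsMatch hop hXmom hk, ← hIw k hk, ofReal_measureReal]

theorem theorem3p1
    (m : ℕ) (L : ℝ → Measure ℝ) (P : ℝ → ℕ → ℝ[X])
    (hprob : ∀ t : ℝ, 0 < t → IsProbabilityMeasure (L t))
    (hadd : ClosedUnderIndepAddition L)
    (hmom : ∀ t : ℝ, 0 < t → Integrable (fun x : ℝ => x ^ (2 * m)) (L t))
    (hP : ∀ t : ℝ, 0 < t → IsMonicOrthogonal m (L t) (P t))
    (n : ℕ) (hn : 1 ≤ n) (lam : Fin n → ℝ) (hlam : ∀ i, 0 < lam i)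
    (c : (Fin n → ℕ) → ℝ)
    (hident : ∀ x : Fin n → ℝ,
      (P (∑ i, lam i) m).eval (∑ i, x i) = ∑ k ∈ multiIndices n m, c k * polyMulti P lam k x) :
    -- the identity for the constants
    alpha L P (∑ i, lam i) m = ∑ k ∈ multiIndices n m, c k * alphaMulti L P lam k ∧
    -- the weights are a probability distribution on the multi-indices of size `m`
    (∀ k ∈ multiIndices n m, 0 ≤ c k * (alphaMulti L P lam k / alpha L P (∑ i, lam i) m)) ∧
    ∑ k ∈ multiIndices n m, c k * (alphaMulti L P lam k / alpha L P (∑ i, lam i) m) = 1 ∧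
    -- `Y i k` has the `X i`-biased distribution of order `k`, for `k ≤ m`
    -- (the variables `Y i k` with `k > m` play no role, and may be taken to be `0`)
    ∀ (Ω : Type*) [MeasurableSpace Ω] (μ : Measure Ω) [IsProbabilityMeasure μ]
      (X : Fin n → Ω → ℝ) (Y : Fin n → ℕ → Ω → ℝ) (I : Ω → Fin n → ℕ),
      (∀ i, Measurable (X i)) → iIndepFun X μ →
      (∀ i, MomentsMatch m (L (lam i)) (μ.map (X i))) →
      (∀ i k, Measurable (Y i k)) →
      (∀ i, ∀ k ≤ m, IsBiased k (fun x => (P (lam i) k).eval x) (μ.map (X i)) (μ.map (Y i k))) →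
      iIndepFun (fun i ω k => Y i k ω) μ →
      Measurable I →
      (∀ k ∈ multiIndices n m, μ.real (I ⁻¹' {k}) =
        c k * (alphaMulti L P lam k / alpha L P (∑ i, lam i) m)) →
      IndepFun I (fun ω i k => Y i k ω) μ →
      IsBiased m (fun x => (P (∑ i, lam i) m).eval x)
        (μ.map (fun ω => ∑ i, X i ω)) (μ.map (fun ω => ∑ i, Y i (I ω i) ω)) := by
  have : Nonempty (Fin n) := Fin.pos_iff_nonempty.1 hn
  have hsum : 0 < ∑ i, lam i := Finset.sum_pos (fun i _ => hlam i) Finset.univ_nonempty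
  have := fun i => hprob _ (hlam i)
  simpa only [biasWeight, prodBiasConst, hadd.sumLaw_eq hprob hlam, biasConst_eq_alpha,
    multiIndices, alphaMulti] using
    theorem3p1_general (fun i => hmom _ (hlam i)) (fun i => hP _ (hlam i))
      ((hP _ hsum).monic m le_rfl) ((hP _ hsum).natDegree_eq m le_rfl) hident
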